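/- Let $\Gamma_1=\Gamma$ be the Euler gamma function and let $\Gamma_2,\Gamma_3$ be the multiple gamma functions. For $m=1,2$, $\Gamma_{m+1}$ is the unique function that is holomorphic on $\mathbb{C}\setminus\{0,-1,-2,\dots\}$ and positive on $(0,\infty)$ and satisfies $$\Gamma_{m+1}(z+1)=\frac{\Gamma_{m+1}(z)}{\Gamma_m(z)},\qquad \Gamma_{m+1}(1)=1,\qquad (-1)^{m+2}\frac{d^{m+2}}{dx^{m+2}}\log\Gamma_{m+1}(x)\ge 0\quad (x>0).$$ Let $\log\Gamma_3$ denote the holomorphic branch of the logarithm of $\Gamma_3$ on $\{\Re(z)>0\}$ that vanishes at $1$, let $\log z$ be the principal logarithm, $\zeta$ the Riemann zeta function and $B_j$ the Bernoulli numbers. Then for every integer $n\ge 0$, as $z\to\infty$ in the half-plane $\Re(z)>0$ (that is, as $|z|\to\infty$, uniformly in that half-plane), $$\begin{aligned}2\log\Gamma_3(z+1)={}&\frac{z^3}{3}\Big(\log z-\frac{11}{6}\Big)-\frac{z^2}{2}\Big(\log z-\frac32+2\zeta'(0)\Big)+\frac{\log z}{12}+z\big(\zeta'(0)+2\zeta'(-1)\big)-\zeta'(-1)-\zeta'(-2)\\&-\sum_{k=1}^{n}\frac{B_{2k+2}}{4k(k+1)z^{2k}}+\sum_{k=1}^{n}\frac{B_{2k+2}}{2(k+1)(2k-1)z^{2k-1}}+O\Big(\frac{1}{z^{2n+1}}\Big).\end{aligned}$$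 -/

import Mathlib

open scoped Asymptotics

/-- `IsMultipleGammaStep n f g` says that `g` is the multiple gamma function of order `n`, given
that `f` is the one of order `n - 1`: `g` is holomorphic away from the nonpositive integers, where
`g (z + 1) = g z / f z`; it is normalized by `g 1 = 1`; and on the positive real axis `g` is
positive and satisfies the convexity condition `(-1)^(n+1) (log g)^(n+1) ≥ 0`. The values at the
nonpositive integers (the poles) are left unspecified. -/
structure IsMultipleGammaStep (n : ℕ) (f g : ℂ → ℂ) : Prop where
  holomorphic : DifferentiableOn ℂ g {z : ℂ | ∀ m : ℕ, z ≠ -(m : ℂ)}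
  map_add_one : ∀ z : ℂ, (∀ m : ℕ, z ≠ -(m : ℂ)) → g (z + 1) = g z / f z
  map_one : g 1 = 1
  pos : ∀ x : ℝ, 0 < x → 0 < (g (x : ℂ)).re ∧ (g (x : ℂ)).im = 0
  convex : ∀ x : ℝ, 0 < x →
    0 ≤ (-1 : ℝ) ^ (n + 1) * iteratedDeriv (n + 1) (fun t : ℝ => Real.log (g (t : ℂ)).re) x

/-- The multiple gamma functions: `Γ₁` is the Euler gamma function, and `Γₙ₊₁` is the function
determined by `Γₙ` through the recurrence, the normalization and the convexity condition. These
conditions determine it away from the nonpositive integers. The value at index `0` is the usual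
convention `Γ₀(z) = 1 / z` and plays no role for the others. -/
noncomputable def multipleGamma : ℕ → ℂ → ℂ
  | 0 => fun z => z⁻¹
  | 1 => Complex.Gamma
  | (n + 2) => Classical.epsilon (IsMultipleGammaStep (n + 2) (multipleGamma (n + 1)))

/-- `log Γₙ` as a holomorphic function on the right half-plane: the branch that vanishes at `1`
(hence is real on the positive reals), obtained by integrating `Γₙ' / Γₙ` along the segment
from `1` to `z`. -/
noncomputable def logMultipleGamma (n : ℕ) (z : ℂ) : ℂ :=
  ∫ t in (0 : ℝ)..1, (z - 1) * logDeriv (multipleGamma n) (1 + (t : ℂ) * (z - 1))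

/-!
For `j = 0, 1, 2`, Euler–Maclaurin summation produces a holomorphic function `logPowZeta j` on the
right half-plane with `logPowZeta j (z + 1) = logPowZeta j z + z ^ j * log z`. It is the
Euler–Maclaurin sum of any order plus a convergent series of remainders
(`logPowZeta_eq`), so its asymptotic expansion is uniform in the half-plane
(`logPowZeta_sub_emSum_isBigO`). Performing the same summation for `z ^ (-s)`, continuing in `s` to
a neighbourhood of `-j` and differentiating there gives `logPowZeta j 1 = ζ'(-j)`
(`logPowZeta_one_eq`); this is where the constants of the expansion come from.

Put `Yⱼ = logPowZeta j - ζ'(-j)`. Then `Y₀`, `Y₁ - (z - 1) Y₀` and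
`((z - 1) (z - 2) Y₀ - (2 z - 3) Y₁ + Y₂) / 2` satisfy the recurrences of `log Γ₁`, `log Γ₂`,
`log Γ₃` and vanish at `1`. They grow slowly enough that, by Cauchy's estimates, their derivatives
of order `2`, `3`, `4` and higher tend to `0` along the positive axis; the recurrence then shows
that these derivatives alternate in sign (`iteratedDeriv_logGammaFormula_nonneg`). The first
function is therefore `log Γ` by the Bohr–Mollerup theorem. The exponentials of the other two
extend by the recurrence to all of the required domain, so the conditions that define `Γ₂` and `Γ₃`
can be met. Any solution agrees with them: the difference of two logarithms on the positive axis is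
periodic, the convexity condition forces one of its derivatives to have constant sign, and Rolle's
theorem then makes it constant (`hasLogGammaFormula_of_isMultipleGammaStep`).

Hence `2 log Γ₃ (z + 1) = z (z - 1) Y₀ - (2 z - 1) Y₁ + Y₂`, the terms in `z ^ j * log z` that come
from the shift cancelling, and it remains to combine the three Euler–Maclaurin sums
(`emSum_combination`).
-/

open Complex Set Filter Topology intervalIntegral

/-! ### Euler–Maclaurin summation on the right half-plane -/

/-- The Euler–Maclaurin sum `∑_{q ≤ N} B_q / q! · φ_q(z)` attached to a sequence `φ` of functions
in which `φ (q + 1)` is the derivative of `φ q`. It is an approximate solution `S` of the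
difference equation `S (z + 1) - S z = φ 1 z`. -/
noncomputable def emSum (φ : ℕ → ℂ → ℂ) (N : ℕ) (z : ℂ) : ℂ :=
  ∑ q ∈ Finset.range (N + 1), (bernoulli q : ℂ) / (q.factorial : ℂ) * φ q z

/-- The defect of the Euler–Maclaurin sum in the difference equation `S (z + 1) - S z = φ 1 z`. -/
noncomputable def emRem (φ : ℕ → ℂ → ℂ) (N : ℕ) (z : ℂ) : ℂ :=
  emSum φ N (z + 1) - emSum φ N z - φ 1 z

lemma re_add_ofReal_pos {z : ℂ} (hz : 0 < z.re) {t : ℝ} (ht : 0 ≤ t) : 0 < (z + t).re := by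
  simp; linarith

lemma re_add_natCast_pos {z : ℂ} (hz : 0 < z.re) (k : ℕ) : 0 < (z + k).re := by
  simp; positivity

lemma hasDerivAt_comp_add_ofReal {g g' : ℂ → ℂ}
    (hg : ∀ z : ℂ, 0 < z.re → HasDerivAt g (g' z) z) {z : ℂ} (hz : 0 < z.re) {t : ℝ}
    (ht : 0 ≤ t) : HasDerivAt (fun t : ℝ => g (z + t)) (g' (z + t)) t := by
  have h1 := hg (z + t) (re_add_ofReal_pos hz ht)
  exact (h1.comp_const_add z (t : ℂ)).comp_ofReal

/-- The defect of the Euler–Maclaurin sum, as an integral against a Bernoulli polynomial. -/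
lemma emRem_eq_integral {φ : ℕ → ℂ → ℂ}
    (hφ : ∀ q, ∀ z : ℂ, 0 < z.re → HasDerivAt (φ q) (φ (q + 1) z) z) {N : ℕ} (hN : 1 ≤ N)
    {z : ℂ} (hz : 0 < z.re) :
    emRem φ N z = (-1) ^ N * ∫ t in (0 : ℝ)..1,
      ((bernoulliFun N t : ℝ) : ℂ) / (N.factorial : ℂ) * φ (N + 1) (z + t) := by
  have hd : ∀ q, ∀ t ∈ uIcc (0 : ℝ) 1,
      HasDerivAt (fun t : ℝ => φ q (z + t)) (φ (q + 1) (z + t)) t := by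
    intro q t ht
    rw [uIcc_of_le zero_le_one] at ht
    exact hasDerivAt_comp_add_ofReal (hφ q) hz ht.1
  have hc : ∀ q, IntervalIntegrable (fun t : ℝ => φ q (z + t)) MeasureTheory.volume 0 1 := by
    intro q
    exact ContinuousOn.intervalIntegrable fun t ht => (hd q t ht).continuousAt.continuousWithinAt
  induction N, hN using Nat.le_induction with
  | base =>
    have hB : ∀ t ∈ uIcc (0 : ℝ) 1,
        HasDerivAt (fun t : ℝ => ((bernoulliFun 1 t : ℝ) : ℂ)) 1 t := by
      intro t _
      simpa using (hasDerivAt_bernoulliFun 1 t).ofReal_comp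
    have key := integral_mul_deriv_eq_deriv_mul hB (hd 1) (by simp) (hc 2)
    have key2 := integral_eq_sub_of_hasDerivAt (hd 0) (hc 1)
    simp only [one_mul, zero_add] at key key2
    rw [key2] at key
    simp only [Nat.factorial_one, Nat.cast_one, div_one, Nat.reduceAdd]
    rw [key]
    simp [emRem, emSum, Finset.sum_range_succ]
    ring
  | succ N hN ih =>
    have hB : ∀ t ∈ uIcc (0 : ℝ) 1,
        HasDerivAt (fun t : ℝ => ((bernoulliFun (N + 1) t : ℝ) : ℂ) / ((N + 1).factorial : ℂ))
          (((bernoulliFun N t : ℝ) : ℂ) / (N.factorial : ℂ)) t := by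
      intro t _
      have := ((hasDerivAt_bernoulliFun (N + 1) t).ofReal_comp).div_const ((N + 1).factorial : ℂ)
      refine this.congr_deriv ?_
      have : (N.factorial : ℂ) ≠ 0 := by exact_mod_cast N.factorial_ne_zero
      have : (N + 1 : ℂ) ≠ 0 := by exact_mod_cast N.succ_ne_zero
      simp [Nat.factorial_succ]
      field_simp
    have hBc : IntervalIntegrable (fun t : ℝ => ((bernoulliFun N t : ℝ) : ℂ) / (N.factorial : ℂ))
        MeasureTheory.volume 0 1 := by
      apply Continuous.intervalIntegrable
      exact (continuous_ofReal.comp (continuous_bernoulliFun N)).div_const _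
    have key := integral_mul_deriv_eq_deriv_mul hB (hd (N + 1)) hBc (hc (N + 2))
    have hs : emRem φ (N + 1) z = emRem φ N z +
        (bernoulli (N + 1) : ℂ) / ((N + 1).factorial : ℂ) * (φ (N + 1) (z + 1) - φ (N + 1) z) := by
      simp only [emRem, emSum, Finset.sum_range_succ _ (N + 1)]
      ring
    rw [hs, ih, key, bernoulliFun_endpoints_eq_of_ne_one (by omega), bernoulliFun_eval_zero]
    -- for odd `N + 1 ≥ 3` the boundary term vanishes with the Bernoulli number
    rcases Nat.even_or_odd N with he | ho
    · have : bernoulli (N + 1) = 0 :=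
        bernoulli_eq_zero_of_odd he.add_one (by omega)
      rw [this, pow_succ, he.neg_one_pow]
      push_cast
      ring
    · rw [pow_succ, ho.neg_one_pow]
      push_cast
      simp
      ring

/-- The constant depends only on the order of summation and not on `φ`, so that the bound is uniform
in families such as `z ^ (-s)` with varying `s`. -/
lemma exists_norm_emRem_le (N : ℕ) (hN : 1 ≤ N) : ∃ C : ℝ, 0 ≤ C ∧ ∀ φ : ℕ → ℂ → ℂ,
    (∀ q, ∀ z : ℂ, 0 < z.re → HasDerivAt (φ q) (φ (q + 1) z) z) → ∀ z : ℂ, 0 < z.re → ∀ M : ℝ,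
    (∀ t : ℝ, 0 ≤ t → ‖φ (N + 1) (z + t)‖ ≤ M) → ‖emRem φ N z‖ ≤ C * M := by
  obtain ⟨B, hB⟩ := isCompact_Icc.exists_bound_of_continuousOn (s := Icc (0 : ℝ) 1)
    (f := bernoulliFun N) (continuous_bernoulliFun N).continuousOn
  have hB0 : 0 ≤ B := (norm_nonneg _).trans (hB 0 (by simp))
  refine ⟨B, hB0, fun φ hφ z hz M hM => ?_⟩
  have hM0 : 0 ≤ M := (norm_nonneg _).trans (hM 0 le_rfl)
  rw [emRem_eq_integral hφ hN hz, norm_mul, norm_pow, norm_neg, norm_one, one_pow, one_mul]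
  have := norm_integral_le_of_norm_le_const (a := (0 : ℝ)) (b := 1) (C := B * M)
    (f := fun t : ℝ => ((bernoulliFun N t : ℝ) : ℂ) / (N.factorial : ℂ) * φ (N + 1) (z + t)) ?_
  · simpa using this
  · intro t ht
    rw [uIoc_of_le zero_le_one] at ht
    rw [norm_mul, norm_div, norm_real, Complex.norm_natCast]
    have h1 : ‖bernoulliFun N t‖ / (N.factorial : ℝ) ≤ B :=
      (div_le_self (norm_nonneg _) (by exact_mod_cast N.factorial_pos)).trans
        (hB t ⟨ht.1.le, ht.2⟩)
    exact mul_le_mul h1 (hM t ht.1.le) (norm_nonneg _) hB0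

lemma norm_le_norm_add_ofReal {z : ℂ} (hz : 0 < z.re) {t : ℝ} (ht : 0 ≤ t) :
    ‖z‖ ≤ ‖z + t‖ := by
  rw [Complex.norm_def, Complex.norm_def]
  apply Real.sqrt_le_sqrt
  simp [normSq_apply]
  nlinarith

lemma sq_add_sq_le_norm_add_sq {z : ℂ} (hz : 0 < z.re) (k : ℕ) :
    ‖z‖ ^ 2 + (k : ℝ) ^ 2 ≤ ‖z + k‖ ^ 2 := by
  rw [← normSq_eq_norm_sq, ← normSq_eq_norm_sq]
  simp [normSq_apply]
  have : (0 : ℝ) ≤ k := k.cast_nonneg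
  nlinarith

/-- Telescoping of the Euler–Maclaurin defects. -/
lemma sum_emRem (φ : ℕ → ℂ → ℂ) (N K : ℕ) (z : ℂ) :
    ∑ k ∈ Finset.range K, emRem φ N (z + k) =
      emSum φ N (z + K) - emSum φ N z - ∑ k ∈ Finset.range K, φ 1 (z + k) := by
  induction K with
  | zero => simp
  | succ K ih =>
    rw [Finset.sum_range_succ, ih, Finset.sum_range_succ, emRem]
    push_cast
    rw [← add_assoc]
    ring

/-! ### Regularized sums of `z ^ j * log z` -/

/-- Coefficient of `z ^ (j + 1 - q) * log z` in the `q`-th member of the sequence `logPow j`. -/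
noncomputable def logPowA (j : ℕ) : ℕ → ℝ
  | 0 => 1 / ((j : ℝ) + 1)
  | q + 1 => ((j : ℝ) + 1 - q) * logPowA j q

/-- Coefficient of `z ^ (j + 1 - q)` in the `q`-th member of the sequence `logPow j`. -/
noncomputable def logPowC (j : ℕ) : ℕ → ℝ
  | 0 => -1 / ((j : ℝ) + 1) ^ 2
  | q + 1 => ((j : ℝ) + 1 - q) * logPowC j q + logPowA j q

/-- The sequence of functions on the right half-plane that starts with a primitive of
`z ^ j * log z`, continues with `z ^ j * log z` itself (index `1`), and in which each member is the
derivative of the one before. -/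
noncomputable def logPow (j q : ℕ) (z : ℂ) : ℂ :=
  z ^ ((j : ℤ) + 1 - q) * (logPowA j q * log z + logPowC j q)

lemma hasDerivAt_logPow (j q : ℕ) (z : ℂ) (hz : 0 < z.re) :
    HasDerivAt (logPow j q) (logPow j (q + 1) z) z := by
  have h0 := ne_zero_of_re_pos hz
  have h1 := hasDerivAt_zpow ((j : ℤ) + 1 - q) z (Or.inl h0)
  have h2 := ((hasDerivAt_log (Or.inl hz)).const_mul (logPowA j q : ℂ)).add_const
    (logPowC j q : ℂ)
  refine (h1.mul h2).congr_deriv ?_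
  have e1 : z ^ ((j : ℤ) + 1 - q) = z ^ ((j : ℤ) + 1 - q - 1) * z := by
    rw [← zpow_add_one₀ h0]; ring_nf
  have e2 : ((j : ℤ) + 1 - ((q + 1 : ℕ) : ℤ)) = (j : ℤ) + 1 - q - 1 := by push_cast; ring
  rw [logPow, e2, e1, logPowA, logPowC]
  push_cast
  field_simp
  ring

lemma logPow_one (j : ℕ) (z : ℂ) : logPow j 1 z = z ^ j * log z := by
  have h : (j : ℝ) + 1 ≠ 0 := by positivity
  have h1 : logPowA j 1 = 1 := by simp [logPowA, h]
  have h2 : logPowC j 1 = 0 := by simp [logPowA, logPowC]; field_simp; ring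
  simp [logPow, h1, h2]

lemma logPowA_eq_zero (j : ℕ) {q : ℕ} (hq : j + 2 ≤ q) : logPowA j q = 0 := by
  induction q, hq using Nat.le_induction with
  | base => simp [logPowA]
  | succ q _ ih => simp [logPowA, ih]

lemma norm_logPow_eq (j : ℕ) {q : ℕ} (hq : j + 2 ≤ q) (z : ℂ) :
    ‖logPow j q z‖ = |logPowC j q| / ‖z‖ ^ (q - 1 - j) := by
  have : ((j : ℤ) + 1 - q) = -((q - 1 - j : ℕ) : ℤ) := by omega
  rw [logPow, logPowA_eq_zero j hq, this, zpow_neg, zpow_natCast]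
  simp [div_eq_mul_inv, mul_comm]

lemma exists_norm_emRem_logPow_le (j : ℕ) {N : ℕ} (hN : j + 1 ≤ N) : ∃ C : ℝ, 0 ≤ C ∧
    ∀ z : ℂ, 0 < z.re → ‖emRem (logPow j) N z‖ ≤ C / ‖z‖ ^ (N - j) := by
  obtain ⟨C, hC, h⟩ := exists_norm_emRem_le N (by omega)
  refine ⟨C * |logPowC j (N + 1)|, by positivity, fun z hz => ?_⟩
  rw [mul_div_assoc]
  refine h _ (hasDerivAt_logPow j) z hz _ fun t ht => ?_
  rw [norm_logPow_eq j (by omega), Nat.add_sub_cancel]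
  have : 0 < ‖z‖ := norm_pos_iff.2 (ne_zero_of_re_pos hz)
  gcongr
  exact norm_le_norm_add_ofReal hz ht

lemma summable_inv_add_sq {δ : ℝ} (hδ : 0 < δ) : Summable fun k : ℕ => 1 / (δ + (k : ℝ) ^ 2) := by
  have h : Summable fun k : ℕ => 1 / (k : ℝ) ^ 2 := Real.summable_one_div_nat_pow.2 one_lt_two
  rw [← summable_nat_add_iff 1] at h ⊢
  refine h.of_nonneg_of_le (fun k => by positivity) fun k => ?_
  gcongr
  push_cast
  linarith

/-- Bound for the shifted defects, uniform in the half-plane. The parameter `ε` makes the series in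
`k` independent of `z`, for use on sets that stay away from `0`. -/
lemma exists_norm_emRem_logPow_add_le (j : ℕ) {N : ℕ} (hN : j + 2 ≤ N) : ∃ C : ℝ, 0 ≤ C ∧
    ∀ z : ℂ, 0 < z.re → ∀ ε : ℝ, 0 < ε → ε ≤ ‖z‖ → ∀ k : ℕ, ‖emRem (logPow j) N (z + k)‖ ≤
      C / ‖z‖ ^ (N - j - 2) * (1 / (ε ^ 2 + (k : ℝ) ^ 2)) := by
  obtain ⟨C, hC, h⟩ := exists_norm_emRem_logPow_le j (N := N) (by omega)
  refine ⟨C, hC, fun z hz ε hε hεz k => (h _ (re_add_natCast_pos hz k)).trans ?_⟩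
  have hz0 : 0 < ‖z‖ := norm_pos_iff.2 (ne_zero_of_re_pos hz)
  rw [div_mul_div_comm, mul_one, show N - j = (N - j - 2) + 2 by omega, pow_add]
  simp only [Nat.add_sub_cancel]
  have h1 : ‖z‖ ≤ ‖z + k‖ := by simpa using norm_le_norm_add_ofReal hz k.cast_nonneg
  have h2 := sq_add_sq_le_norm_add_sq hz k
  have h3 : ε ^ 2 ≤ ‖z‖ ^ 2 := by gcongr
  gcongr
  linarith

lemma summable_emRem_logPow (j : ℕ) {N : ℕ} (hN : j + 2 ≤ N) {z : ℂ} (hz : 0 < z.re) :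
    Summable fun k : ℕ => emRem (logPow j) N (z + k) := by
  obtain ⟨C, hC, h⟩ := exists_norm_emRem_logPow_add_le j hN
  have hz0 : 0 < ‖z‖ := norm_pos_iff.2 (ne_zero_of_re_pos hz)
  exact Summable.of_norm_bounded ((summable_inv_add_sq (pow_pos hz0 2)).mul_left _)
    (h z hz _ hz0 le_rfl)

/-- The regularization of `-∑_k (z + k) ^ j * log (z + k)`, which is the derivative at `s = -j` of
the Hurwitz zeta function `ζ(s, z)`. It is defined through Euler–Maclaurin summation. -/
noncomputable def logPowZeta (j : ℕ) (z : ℂ) : ℂ :=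
  emSum (logPow j) (j + 3) z + ∑' k : ℕ, emRem (logPow j) (j + 3) (z + k)

lemma tendsto_logPow_add_natCast (j : ℕ) {q : ℕ} (hq : j + 2 ≤ q) (z : ℂ) :
    Tendsto (fun K : ℕ => logPow j q (z + K)) atTop (𝓝 0) := by
  rw [tendsto_zero_iff_norm_tendsto_zero]
  simp only [norm_logPow_eq j hq]
  apply Tendsto.const_div_atTop
  apply (tendsto_pow_atTop (by omega)).comp
  have h1 : Tendsto (fun K : ℕ => (K : ℝ) - ‖z‖) atTop atTop :=
    tendsto_atTop_add_const_right _ _ tendsto_natCast_atTop_atTop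
  refine tendsto_atTop_mono (fun K => ?_) h1
  have := norm_sub_le (z + K) z
  rw [add_sub_cancel_left, Complex.norm_natCast] at this
  linarith

lemma tendsto_emSum_logPow_sub (j : ℕ) {N : ℕ} (hN : j + 2 ≤ N) {z : ℂ} (hz : 0 < z.re) :
    Tendsto (fun K : ℕ => emSum (logPow j) N (z + K) -
      ∑ k ∈ Finset.range K, logPow j 1 (z + k)) atTop
      (𝓝 (emSum (logPow j) N z + ∑' k : ℕ, emRem (logPow j) N (z + k))) := by
  have h := (summable_emRem_logPow j hN hz).hasSum.tendsto_sum_nat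
  refine (h.const_add (emSum (logPow j) N z)).congr fun K => ?_
  rw [sum_emRem]
  ring

lemma tendsto_logPowZeta (j : ℕ) {z : ℂ} (hz : 0 < z.re) :
    Tendsto (fun K : ℕ => emSum (logPow j) (j + 3) (z + K) -
      ∑ k ∈ Finset.range K, logPow j 1 (z + k)) atTop (𝓝 (logPowZeta j z)) :=
  tendsto_emSum_logPow_sub j (by omega) hz

/-- The order of the Euler–Maclaurin summation does not matter. -/
lemma logPowZeta_eq (j : ℕ) {N : ℕ} (hN : j + 3 ≤ N) {z : ℂ} (hz : 0 < z.re) :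
    logPowZeta j z = emSum (logPow j) N z + ∑' k : ℕ, emRem (logPow j) N (z + k) := by
  suffices h : Tendsto (fun K : ℕ => emSum (logPow j) N (z + K) -
      ∑ k ∈ Finset.range K, logPow j 1 (z + k)) atTop (𝓝 (logPowZeta j z)) from
    tendsto_nhds_unique h (tendsto_emSum_logPow_sub j (by omega) hz)
  induction N, hN using Nat.le_induction with
  | base => exact tendsto_logPowZeta j hz
  | succ N hN ih =>
    have h := ih.add ((tendsto_logPow_add_natCast j (q := N + 1) (by omega) z).const_mul
      ((bernoulli (N + 1) : ℂ) / ((N + 1).factorial : ℂ)))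
    rw [mul_zero, add_zero] at h
    refine h.congr fun K => ?_
    simp only [emSum, Finset.sum_range_succ _ (N + 1)]
    ring

lemma logPowZeta_add_one (j : ℕ) {z : ℂ} (hz : 0 < z.re) :
    logPowZeta j (z + 1) = logPowZeta j z + z ^ j * log z := by
  have h := (summable_emRem_logPow j (N := j + 3) (by omega) hz).tsum_eq_zero_add
  rw [logPowZeta, logPowZeta, h, ← logPow_one]
  have : ∀ k : ℕ, z + 1 + (k : ℂ) = z + ((k + 1 : ℕ) : ℂ) := fun k => by push_cast; ring
  simp only [this, emRem]
  simp
  ring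

lemma differentiableAt_emSum_logPow (j N : ℕ) {z : ℂ} (hz : 0 < z.re) :
    DifferentiableAt ℂ (emSum (logPow j) N) z := by
  unfold emSum
  exact DifferentiableAt.fun_sum fun q _ =>
    (hasDerivAt_logPow j q z hz).differentiableAt.const_mul _

lemma differentiableAt_emRem_logPow (j N : ℕ) {z : ℂ} (hz : 0 < z.re) :
    DifferentiableAt ℂ (emRem (logPow j) N) z := by
  have h1 : 0 < (z + 1).re := by simp; linarith
  unfold emRem
  exact ((differentiableAt_comp_add_const.2 (differentiableAt_emSum_logPow j N h1)).sub
    (differentiableAt_emSum_logPow j N hz)).sub (hasDerivAt_logPow j 1 z hz).differentiableAt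

lemma differentiableAt_logPowZeta (j : ℕ) {z : ℂ} (hz : 0 < z.re) :
    DifferentiableAt ℂ (logPowZeta j) z := by
  have hU : IsOpen {w : ℂ | z.re / 2 < w.re} := isOpen_lt continuous_const continuous_re
  obtain ⟨C, hC, h⟩ := exists_norm_emRem_logPow_add_le j (N := j + 3) (by omega)
  have hε : 0 < z.re / 2 := by linarith
  have key := Complex.differentiableOn_tsum_of_summable_norm
    (F := fun (k : ℕ) w => emRem (logPow j) (j + 3) (w + k))
    ((summable_inv_add_sq (pow_pos hε 2)).mul_left (C / (z.re / 2) ^ 1))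
    (U := {w | z.re / 2 < w.re})
    (fun k w hw => ?_) hU (fun k w hw => ?_)
  · have hz' : {w : ℂ | z.re / 2 < w.re} ∈ 𝓝 z := hU.mem_nhds (by simp; linarith)
    exact (differentiableAt_emSum_logPow j _ hz).add (key.differentiableAt hz')
  · have hw0 : 0 < w.re := hε.trans hw
    exact (differentiableAt_comp_add_const.2
      (differentiableAt_emRem_logPow j _ (re_add_natCast_pos hw0 k))).differentiableWithinAt
  · have hw0 : 0 < w.re := hε.trans hw
    have hw1 : z.re / 2 ≤ ‖w‖ := (le_of_lt hw).trans (re_le_norm w)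
    refine (h w hw0 _ hε hw1 k).trans ?_
    rw [show j + 3 - j - 2 = 1 by omega]
    gcongr

lemma logPow_ofReal_im (j q : ℕ) {x : ℝ} (hx : 0 < x) : (logPow j q x).im = 0 := by
  have : logPow j q x =
      ((x ^ ((j : ℤ) + 1 - q) * (logPowA j q * Real.log x + logPowC j q) : ℝ) : ℂ) := by
    rw [logPow, ← ofReal_log hx.le]; push_cast; ring
  rw [this, ofReal_im]

lemma logPowZeta_ofReal_im (j : ℕ) {x : ℝ} (hx : 0 < x) : (logPowZeta j x).im = 0 := by
  have h := (continuous_im.tendsto _).comp (tendsto_logPowZeta j (z := x) (by simpa using hx))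
  refine tendsto_nhds_unique h (tendsto_const_nhds.congr fun K => ?_)
  have h1 : ∀ k : ℕ, ∀ q, (logPow j q ((x : ℂ) + k)).im = 0 := fun k q => by
    have := logPow_ofReal_im j q (x := x + k) (by positivity)
    simpa using this
  have h2 : ∀ q : ℕ, ((bernoulli q : ℂ) / (q.factorial : ℂ)).im = 0 := fun q => by
    have : ((bernoulli q : ℂ) / (q.factorial : ℂ)) =
      (((bernoulli q : ℝ) / (q.factorial : ℝ) : ℝ) : ℂ) := by push_cast; rfl
    rw [this, ofReal_im]
  simp [emSum, im_sum, h1, h2, mul_im]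

/-- The part of the open right half-plane outside the open unit disc. Estimates along the principal
filter of this set are uniform up to the imaginary axis. -/
def farHalfPlane : Set ℂ := {z | 0 < z.re ∧ 1 ≤ ‖z‖}

/-- The asymptotic expansion of `logPowZeta`, with an error bound that is two powers weaker than
the first omitted term. -/
lemma logPowZeta_sub_emSum_isBigO (j : ℕ) {N : ℕ} (hN : j + 3 ≤ N) :
    (fun z => logPowZeta j z - emSum (logPow j) N z) =O[𝓟 farHalfPlane]
      fun z => 1 / z ^ (N - j - 2) := by
  obtain ⟨C, hC, h⟩ := exists_norm_emRem_logPow_add_le j (N := N) (by omega)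
  rw [Asymptotics.isBigO_principal]
  have hs := summable_inv_add_sq (one_pos.trans_eq (one_pow 2).symm)
  refine ⟨C * ∑' k : ℕ, 1 / (1 ^ 2 + (k : ℝ) ^ 2), fun z hz => ?_⟩
  rw [logPowZeta_eq j hN hz.1, add_sub_cancel_left]
  refine (tsum_of_norm_bounded (hs.mul_left _).hasSum
    (h z hz.1 1 one_pos hz.2)).trans (le_of_eq ?_)
  rw [tsum_mul_left, norm_div, norm_one, norm_pow]
  ring

/-! ### Identification of the constants with derivatives of the zeta function -/

/-- Coefficients of the sequence `cpowSeq s`. -/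
noncomputable def cpowCoeff (s : ℂ) : ℕ → ℂ
  | 0 => 1 / (1 - s)
  | q + 1 => (1 - s - q) * cpowCoeff s q

/-- The analogue of `logPow` for the function `z ^ (-s)`: a primitive of it, the function itself
(index `1`), and its successive derivatives. -/
noncomputable def cpowSeq (s : ℂ) (q : ℕ) (z : ℂ) : ℂ :=
  cpowCoeff s q * z ^ (1 - s - q)

lemma hasDerivAt_cpowSeq (s : ℂ) (q : ℕ) (z : ℂ) (hz : 0 < z.re) :
    HasDerivAt (cpowSeq s q) (cpowSeq s (q + 1) z) z := by
  have h := ((hasDerivAt_id z).cpow_const (c := 1 - s - q) (Or.inl hz)).const_mul (cpowCoeff s q)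
  refine h.congr_deriv ?_
  simp only [cpowSeq, cpowCoeff, id, mul_one]
  push_cast
  rw [show 1 - s - ((q : ℂ) + 1) = 1 - s - q - 1 by ring]
  ring

lemma cpowCoeff_one {s : ℂ} (hs : s ≠ 1) : cpowCoeff s 1 = 1 := by
  have : 1 - s ≠ 0 := sub_ne_zero.2 hs.symm
  simp [cpowCoeff, this]

lemma cpowSeq_one {s : ℂ} (hs : s ≠ 1) (z : ℂ) : cpowSeq s 1 z = z ^ (-s) := by
  rw [cpowSeq, cpowCoeff_one hs]
  simp

lemma differentiableAt_cpowCoeff {s : ℂ} (hs : s ≠ 1) (q : ℕ) :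
    DifferentiableAt ℂ (fun s => cpowCoeff s q) s := by
  induction q with
  | zero =>
    have : 1 - s ≠ 0 := sub_ne_zero.2 hs.symm
    simp only [cpowCoeff]
    fun_prop (disch := assumption)
  | succ q ih =>
    simp only [cpowCoeff]
    fun_prop

lemma differentiableAt_cpowSeq {s : ℂ} (hs : s ≠ 1) (q : ℕ) {z : ℂ} (hz : 0 < z.re) :
    DifferentiableAt ℂ (fun s => cpowSeq s q z) s := by
  have h := differentiableAt_cpowCoeff hs q
  have h0 : z ≠ 0 := ne_zero_of_re_pos hz
  unfold cpowSeq
  refine h.mul (DifferentiableAt.const_cpow (by fun_prop) (Or.inl h0))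

lemma neg_natCast_ne_one (j : ℕ) : (-(j : ℂ)) ≠ 1 := by
  intro h
  have := congrArg re h
  simp at this
  have : (0 : ℝ) ≤ j := j.cast_nonneg
  linarith

lemma cpowCoeff_neg_natCast (j q : ℕ) : cpowCoeff (-(j : ℂ)) q = logPowA j q := by
  induction q with
  | zero => simp [cpowCoeff, logPowA, add_comm]
  | succ q ih => simp only [cpowCoeff, logPowA, ih]; push_cast; ring

lemma hasDerivAt_cpowCoeff (j q : ℕ) :
    HasDerivAt (fun s => cpowCoeff s q) (-(logPowC j q : ℂ)) (-(j : ℂ)) := by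
  induction q with
  | zero =>
    have h0 : 1 - (-(j : ℂ)) ≠ 0 := sub_ne_zero.2 (neg_natCast_ne_one j).symm
    have h1 := ((hasDerivAt_id (-(j : ℂ))).const_sub 1).fun_inv h0
    simp only [cpowCoeff, logPowC, one_div]
    refine h1.congr_deriv ?_
    simp only [id]
    push_cast
    rw [show (1 - (-(j : ℂ))) = (j : ℂ) + 1 by ring]
    ring
  | succ q ih =>
    simp only [cpowCoeff, logPowC]
    have h1 := (((hasDerivAt_id (-(j : ℂ))).const_sub 1).sub_const (q : ℂ)).mul ih
    refine h1.congr_deriv ?_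
    simp only [id, cpowCoeff_neg_natCast]
    push_cast
    ring

/-- Differentiating the family `z ^ (-s)` in `s` at `s = -j` gives `-z ^ j * log z`, compatibly
with primitives and derivatives in `z`. -/
lemma hasDerivAt_cpowSeq_param (j q : ℕ) {z : ℂ} (hz : 0 < z.re) :
    HasDerivAt (fun s => cpowSeq s q z) (-logPow j q z) (-(j : ℂ)) := by
  have h0 : z ≠ 0 := ne_zero_of_re_pos hz
  have h1 := (((hasDerivAt_id (-(j : ℂ))).const_sub 1).sub_const (q : ℂ)).const_cpow
    (c := z) (Or.inl h0)
  refine ((hasDerivAt_cpowCoeff j q).mul h1).congr_deriv ?_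
  have e : z ^ (1 - -(j : ℂ) - q) = z ^ ((j : ℤ) + 1 - q) := by
    rw [← cpow_intCast]; push_cast; congr 1; ring
  simp only [id, e, cpowCoeff_neg_natCast, logPow]
  ring

lemma hasDerivAt_emSum_cpowSeq (j N : ℕ) {z : ℂ} (hz : 0 < z.re) :
    HasDerivAt (fun s => emSum (cpowSeq s) N z) (-emSum (logPow j) N z) (-(j : ℂ)) := by
  unfold emSum
  refine (HasDerivAt.fun_sum fun q _ =>
    (hasDerivAt_cpowSeq_param j q hz).const_mul _).congr_deriv ?_
  simp

lemma hasDerivAt_emRem_cpowSeq (j N : ℕ) {z : ℂ} (hz : 0 < z.re) :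
    HasDerivAt (fun s => emRem (cpowSeq s) N z) (-emRem (logPow j) N z) (-(j : ℂ)) := by
  have h1 : 0 < (z + 1).re := by simp; linarith
  unfold emRem
  refine (((hasDerivAt_emSum_cpowSeq j N h1).fun_sub (hasDerivAt_emSum_cpowSeq j N hz)).fun_sub
    (hasDerivAt_cpowSeq_param j 1 hz)).congr_deriv ?_
  ring

lemma differentiableAt_emSum_cpowSeq {s : ℂ} (hs : s ≠ 1) (N : ℕ) {z : ℂ} (hz : 0 < z.re) :
    DifferentiableAt ℂ (fun s => emSum (cpowSeq s) N z) s := by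
  unfold emSum
  exact DifferentiableAt.fun_sum fun q _ => (differentiableAt_cpowSeq hs q hz).const_mul _

lemma differentiableAt_emRem_cpowSeq {s : ℂ} (hs : s ≠ 1) (N : ℕ) {z : ℂ} (hz : 0 < z.re) :
    DifferentiableAt ℂ (fun s => emRem (cpowSeq s) N z) s := by
  have h1 : 0 < (z + 1).re := by simp; linarith
  unfold emRem
  exact ((differentiableAt_emSum_cpowSeq hs N h1).fun_sub
    (differentiableAt_emSum_cpowSeq hs N hz)).fun_sub (differentiableAt_cpowSeq hs 1 hz)

lemma exists_norm_cpowCoeff_le (R : ℝ) (q : ℕ) : ∃ B : ℝ, 0 ≤ B ∧ ∀ s : ℂ, s ≠ 1 → ‖s‖ ≤ R →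
    ‖cpowCoeff s (q + 1)‖ ≤ B := by
  induction q with
  | zero => exact ⟨1, zero_le_one, fun s hs _ => by simp [cpowCoeff_one hs]⟩
  | succ q ih =>
    obtain ⟨B, hB, h⟩ := ih
    refine ⟨|1 + R + (q + 1 : ℕ)| * B, by positivity, fun s hs hR => ?_⟩
    rw [cpowCoeff, norm_mul]
    refine mul_le_mul ?_ (h s hs hR) (norm_nonneg _) (abs_nonneg _)
    refine le_trans ?_ (le_abs_self _)
    calc ‖1 - s - ((q + 1 : ℕ) : ℂ)‖ ≤ ‖(1 : ℂ) - s‖ + ‖((q + 1 : ℕ) : ℂ)‖ := norm_sub_le _ _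
      _ ≤ ‖(1 : ℂ)‖ + ‖s‖ + ((q + 1 : ℕ) : ℝ) := by
        rw [Complex.norm_natCast]; gcongr; exact norm_sub_le _ _
      _ ≤ _ := by rw [norm_one]; gcongr

/-- A star-shaped neighbourhood of `-j` that meets the half-plane of convergence of the zeta series
and avoids the pole of `ζ`. -/
def zetaRegion (j : ℕ) : Set ℂ :=
  {s | -((j : ℝ) + 1) < s.re ∧ ‖s‖ < j + 3 ∧ 1 - s ∈ slitPlane}

lemma isOpen_zetaRegion (j : ℕ) : IsOpen (zetaRegion j) :=
  (isOpen_lt continuous_const continuous_re).inter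
    ((isOpen_lt continuous_norm continuous_const).inter
      (isOpen_slitPlane.preimage (continuous_const.sub continuous_id)))

lemma ne_one_of_mem_zetaRegion {j : ℕ} {s : ℂ} (hs : s ∈ zetaRegion j) : s ≠ 1 := by
  rintro rfl
  exact slitPlane_ne_zero hs.2.2 (sub_self 1)

lemma neg_natCast_mem_zetaRegion (j : ℕ) : (-(j : ℂ)) ∈ zetaRegion j := by
  refine ⟨by simp, by simp, Or.inl ?_⟩
  simp; positivity

lemma isPreconnected_zetaRegion (j : ℕ) : IsPreconnected (zetaRegion j) := by
  have h : StarConvex ℝ 0 (zetaRegion j) := by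
    rw [starConvex_iff_segment_subset]
    intro s hs w hw
    rw [segment_eq_image] at hw
    obtain ⟨t, ⟨ht0, ht1⟩, rfl⟩ := hw
    have hj : (0 : ℝ) ≤ j := j.cast_nonneg
    obtain ⟨h1, h2, h3⟩ := hs
    refine ⟨?_, ?_, ?_⟩
    · simp only [smul_zero, zero_add, real_smul, re_ofReal_mul]
      rcases ht0.eq_or_lt with rfl | ht
      · linarith
      · nlinarith [mul_pos ht (by linarith : 0 < s.re + (j + 1))]
    · simp only [smul_zero, zero_add, norm_smul, Real.norm_eq_abs, abs_of_nonneg ht0]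
      have := norm_nonneg s
      nlinarith
    · have := starConvex_one_slitPlane h3 (a := 1 - t) (b := t) (by linarith) ht0 (by ring)
      convert this using 1
      simp only [smul_zero, zero_add, real_smul]
      push_cast
      ring
  have hj : -((j : ℝ) + 1) < 0 := by rw [neg_lt_zero]; positivity
  have h0 : (0 : ℂ) ∈ zetaRegion j := ⟨hj, by simp; positivity, by simp⟩
  exact (h.isPathConnected h0).isConnected.isPreconnected

lemma exists_norm_emRem_cpowSeq_le (j : ℕ) : ∃ C : ℝ, ∀ s ∈ zetaRegion j, ∀ k : ℕ,
    ‖emRem (cpowSeq s) (j + 3) (1 + k)‖ ≤ C * (1 / ((k + 1 : ℕ) : ℝ) ^ 2) := by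
  obtain ⟨C, hC, h⟩ := exists_norm_emRem_le (j + 3) (by omega)
  obtain ⟨B, hB, hB'⟩ := exists_norm_cpowCoeff_le (j + 3) (j + 3)
  refine ⟨C * B, fun s hs k => ?_⟩
  rw [mul_assoc]
  have hk : 0 < ((1 : ℂ) + k).re := by simp; positivity
  refine h _ (hasDerivAt_cpowSeq s) _ hk _ fun t ht => ?_
  rw [cpowSeq, norm_mul]
  refine mul_le_mul (hB' s (ne_one_of_mem_zetaRegion hs) hs.2.1.le) ?_ (norm_nonneg _) hB
  have hk0 : (0 : ℝ) ≤ k := k.cast_nonneg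
  have e : (1 : ℂ) + k + t = ((1 + k + t : ℝ) : ℂ) := by push_cast; rfl
  have h1 : (1 : ℝ) ≤ 1 + k + t := by linarith
  rw [e, norm_cpow_eq_rpow_re_of_pos (by linarith)]
  have h2 : (1 - s - ((j + 3 + 1 : ℕ) : ℂ)).re ≤ -2 := by
    have := hs.1
    simp
    linarith
  refine (Real.rpow_le_rpow_of_exponent_le h1 h2).trans ?_
  rw [Real.rpow_neg (by linarith), ← one_div]
  rw [show (2 : ℝ) = ((2 : ℕ) : ℝ) by norm_num, Real.rpow_natCast]
  refine one_div_le_one_div_of_le (by positivity) (pow_le_pow_left₀ (by positivity) ?_ 2)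
  push_cast
  linarith

lemma tendsto_emSum_cpowSeq {s : ℂ} (hs : 1 < s.re) (N : ℕ) :
    Tendsto (fun K : ℕ => emSum (cpowSeq s) N (1 + K)) atTop (𝓝 0) := by
  unfold emSum
  rw [← Finset.sum_const_zero (s := Finset.range (N + 1))]
  refine tendsto_finsetSum _ fun q _ => ?_
  rw [← mul_zero ((bernoulli q : ℂ) / (q.factorial : ℂ))]
  refine Tendsto.const_mul _ ?_
  unfold cpowSeq
  rw [← mul_zero (cpowCoeff s q)]
  refine Tendsto.const_mul _ ?_
  rw [tendsto_zero_iff_norm_tendsto_zero]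
  have h1 : ∀ K : ℕ, ‖((1 : ℂ) + K) ^ (1 - s - q)‖ = ((1 : ℝ) + K) ^ (-(s.re - 1 + q)) := by
    intro K
    have e : (1 : ℂ) + K = ((1 + K : ℝ) : ℂ) := by push_cast; rfl
    rw [e, norm_cpow_eq_rpow_re_of_pos (by positivity)]
    congr 1
    simp
    ring
  simp only [h1]
  have hq : (0 : ℝ) ≤ q := q.cast_nonneg
  exact (tendsto_rpow_neg_atTop (by linarith)).comp
    (tendsto_atTop_add_const_left _ _ tendsto_natCast_atTop_atTop)

/-- Euler–Maclaurin summation of the zeta series. -/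
lemma riemannZeta_eq_of_one_lt_re {j : ℕ} {s : ℂ} (hs : s ∈ zetaRegion j) (h1 : 1 < s.re) :
    riemannZeta s = -emSum (cpowSeq s) (j + 3) 1 -
      ∑' k : ℕ, emRem (cpowSeq s) (j + 3) (1 + k) := by
  obtain ⟨C, hC⟩ := exists_norm_emRem_cpowSeq_le j
  have hsum : Summable fun k : ℕ => emRem (cpowSeq s) (j + 3) (1 + k) := by
    refine Summable.of_norm_bounded (Summable.mul_left C ?_) (hC s hs)
    exact (summable_nat_add_iff 1).2 (Real.summable_one_div_nat_pow.2 one_lt_two)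
  have h2 : Summable fun k : ℕ => 1 / ((k : ℂ) + 1) ^ s := by
    have := (summable_nat_add_iff 1).2 (Complex.summable_one_div_nat_cpow.2 h1)
    simpa using this
  have h3 := h2.hasSum.tendsto_sum_nat
  rw [← zeta_eq_tsum_one_div_nat_add_one_cpow h1] at h3
  have h4 := ((tendsto_emSum_cpowSeq h1 (j + 3)).sub_const
    (emSum (cpowSeq s) (j + 3) 1)).sub h3
  have h5 := tendsto_nhds_unique hsum.hasSum.tendsto_sum_nat (h4.congr fun K => ?_)
  · rw [h5]; ring
  · rw [sum_emRem]
    congr 1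
    refine Finset.sum_congr rfl fun k _ => ?_
    rw [cpowSeq_one (ne_one_of_mem_zetaRegion hs), cpow_neg, one_div, add_comm]

/-- The regularized values at `1` are derivatives of the Riemann zeta function. -/
lemma logPowZeta_one_eq (j : ℕ) : logPowZeta j 1 = deriv riemannZeta (-(j : ℂ)) := by
  obtain ⟨C, hC⟩ := exists_norm_emRem_cpowSeq_le j
  have hO := isOpen_zetaRegion j
  have hu : Summable fun k : ℕ => C * (1 / ((k + 1 : ℕ) : ℝ) ^ 2) :=
    ((summable_nat_add_iff 1).2 (Real.summable_one_div_nat_pow.2 one_lt_two)).mul_left C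
  have hk : ∀ k : ℕ, 0 < ((1 : ℂ) + k).re := fun k => by simp; positivity
  have hd : ∀ k : ℕ, DifferentiableOn ℂ (fun s => emRem (cpowSeq s) (j + 3) (1 + k))
      (zetaRegion j) := fun k s hs => (differentiableAt_emRem_cpowSeq
        (ne_one_of_mem_zetaRegion hs) _ (hk k)).differentiableWithinAt
  have hT := differentiableOn_tsum_of_summable_norm hu hd hO fun k s hs => hC s hs k
  have hmem := neg_natCast_mem_zetaRegion j
  have hS := hasSum_deriv_of_summable_norm hu hd hO (fun k s hs => hC s hs k) hmem
  have hE : DifferentiableOn ℂ (fun s => -emSum (cpowSeq s) (j + 3) 1 -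
      ∑' k : ℕ, emRem (cpowSeq s) (j + 3) (1 + k)) (zetaRegion j) :=
    DifferentiableOn.fun_sub (fun s hs => (differentiableAt_emSum_cpowSeq
      (ne_one_of_mem_zetaRegion hs) _ (by simp)).fun_neg.differentiableWithinAt) hT
  have hZ : DifferentiableOn ℂ riemannZeta (zetaRegion j) := fun s hs =>
    (differentiableAt_riemannZeta (ne_one_of_mem_zetaRegion hs)).differentiableWithinAt
  have hp : (2 + I : ℂ) ∈ zetaRegion j := by
    have hj : (0 : ℝ) ≤ j := j.cast_nonneg
    refine ⟨by simp; linarith, ?_, Or.inr (by simp)⟩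
    have : ‖(2 + I : ℂ)‖ < 3 := by
      rw [Complex.norm_def, Real.sqrt_lt' (by norm_num)]
      simp [normSq_apply]; norm_num
    linarith
  have hev : riemannZeta =ᶠ[𝓝 (2 + I)] fun s => -emSum (cpowSeq s) (j + 3) 1 -
      ∑' k : ℕ, emRem (cpowSeq s) (j + 3) (1 + k) := by
    have h1 : {s : ℂ | 1 < s.re} ∈ 𝓝 (2 + I : ℂ) :=
      (isOpen_lt continuous_const continuous_re).mem_nhds (by simp)
    filter_upwards [hO.mem_nhds hp, h1] with s hs hs1
    exact riemannZeta_eq_of_one_lt_re hs hs1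
  have hEq := (hZ.analyticOnNhd hO).eqOn_of_preconnected_of_eventuallyEq (hE.analyticOnNhd hO)
    (isPreconnected_zetaRegion j) hp hev
  rw [(hEq.eventuallyEq_of_mem (hO.mem_nhds hmem)).deriv_eq]
  have h1 := hasDerivAt_emSum_cpowSeq j (j + 3) (z := 1) (by simp)
  have h2 := (hT.differentiableAt (hO.mem_nhds hmem)).hasDerivAt
  rw [(h1.fun_neg.fun_sub h2).deriv, ← hS.tsum_eq]
  simp only [(hasDerivAt_emRem_cpowSeq j (j + 3) (hk _)).deriv]
  rw [tsum_neg, logPowZeta]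
  ring

/-! ### Explicit logarithms of the multiple gamma functions -/

lemma isBigO_farHalfPlane_sqrt_of_const (c : ℂ) :
    (fun _ : ℂ => c) =O[𝓟 farHalfPlane] fun z => √‖z‖ := by
  rw [Asymptotics.isBigO_principal]
  refine ⟨‖c‖, fun z hz => ?_⟩
  have : 1 ≤ √‖z‖ := Real.one_le_sqrt.2 hz.2
  rw [Real.norm_of_nonneg (Real.sqrt_nonneg _)]
  exact le_mul_of_one_le_right (norm_nonneg _) this

lemma log_isBigO_sqrt : log =O[𝓟 farHalfPlane] fun z => √‖z‖ := by
  rw [Asymptotics.isBigO_principal]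
  refine ⟨2 + Real.pi, fun z hz => ?_⟩
  have h1 : 1 ≤ √‖z‖ := Real.one_le_sqrt.2 hz.2
  rw [Real.norm_of_nonneg (Real.sqrt_nonneg _)]
  have h2 := norm_le_abs_re_add_abs_im (log z)
  rw [log_re, log_im, abs_of_nonneg (Real.log_nonneg hz.2)] at h2
  have h3 := abs_arg_le_pi z
  have h4 := Real.log_le_sub_one_of_pos (zero_lt_one.trans_le h1)
  rw [Real.log_sqrt (norm_nonneg _)] at h4
  have := Real.pi_pos
  nlinarith

lemma zpow_isBigO_pow {a : ℤ} {b : ℕ} (h : a ≤ b) :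
    (fun z : ℂ => z ^ a) =O[𝓟 farHalfPlane] fun z => ‖z‖ ^ b := by
  rw [Asymptotics.isBigO_principal]
  refine ⟨1, fun z hz => ?_⟩
  rw [one_mul, norm_zpow, norm_pow, norm_norm, ← zpow_natCast]
  exact zpow_le_zpow_right₀ hz.2 h

lemma logPow_isBigO (j q : ℕ) :
    logPow j q =O[𝓟 farHalfPlane] fun z => ‖z‖ ^ (j + 1) * √‖z‖ :=
  (zpow_isBigO_pow (by push_cast; omega)).mul
    ((log_isBigO_sqrt.const_mul_left _).add (isBigO_farHalfPlane_sqrt_of_const _))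

lemma logPowZeta_isBigO (j : ℕ) :
    logPowZeta j =O[𝓟 farHalfPlane] fun z => ‖z‖ ^ (j + 1) * √‖z‖ := by
  have h1 : emSum (logPow j) (j + 3) =O[𝓟 farHalfPlane] fun z => ‖z‖ ^ (j + 1) * √‖z‖ := by
    unfold emSum
    exact Asymptotics.IsBigO.fun_sum fun q _ => (logPow_isBigO j q).const_mul_left _
  have h2 : (fun z => logPowZeta j z - emSum (logPow j) (j + 3) z) =O[𝓟 farHalfPlane]
      fun z => ‖z‖ ^ (j + 1) * √‖z‖ := by
    refine (logPowZeta_sub_emSum_isBigO j le_rfl).trans ?_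
    have h3 := (zpow_isBigO_pow (a := -1) (b := j + 1) (by omega)).mul
      (isBigO_farHalfPlane_sqrt_of_const 1)
    refine h3.congr_left fun z => ?_
    rw [show j + 3 - j - 2 = 1 by omega]
    simp
  simpa using h1.add h2

/-- `logPowZeta`, normalized to vanish at `1`. -/
noncomputable def logPowSum (j : ℕ) (z : ℂ) : ℂ := logPowZeta j z - logPowZeta j 1

lemma logPowSum_one (j : ℕ) : logPowSum j 1 = 0 := sub_self _

lemma logPowSum_add_one (j : ℕ) {z : ℂ} (hz : 0 < z.re) :
    logPowSum j (z + 1) = logPowSum j z + z ^ j * log z := by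
  rw [logPowSum, logPowSum, logPowZeta_add_one j hz]
  ring

lemma differentiableAt_logPowSum (j : ℕ) {z : ℂ} (hz : 0 < z.re) :
    DifferentiableAt ℂ (logPowSum j) z :=
  (differentiableAt_logPowZeta j hz).sub_const _

lemma logPowSum_ofReal_im (j : ℕ) {x : ℝ} (hx : 0 < x) : (logPowSum j x).im = 0 := by
  have := logPowZeta_ofReal_im j one_pos
  rw [ofReal_one] at this
  rw [logPowSum, sub_im, logPowZeta_ofReal_im j hx, this, sub_zero]

lemma logPowSum_isBigO (j : ℕ) :
    logPowSum j =O[𝓟 farHalfPlane] fun z => ‖z‖ ^ (j + 1) * √‖z‖ := by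
  have h := (zpow_isBigO_pow (a := 0) (b := j + 1) (by omega)).mul
    (isBigO_farHalfPlane_sqrt_of_const (logPowZeta j 1))
  exact (logPowZeta_isBigO j).sub (h.congr_left fun z => by simp)

/-- Explicit holomorphic logarithms of `Γ₀, Γ₁, Γ₂, Γ₃` on the right half-plane. Only the indices up
to `3` are meaningful; larger ones repeat the formula for `3`. -/
noncomputable def logGammaFormula : ℕ → ℂ → ℂ
  | 0 => fun z => -log z
  | 1 => fun z => logPowSum 0 z
  | 2 => fun z => logPowSum 1 z - (z - 1) * logPowSum 0 z
  | _ => fun z => ((z - 1) * (z - 2) * logPowSum 0 z - (2 * z - 3) * logPowSum 1 z +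
      logPowSum 2 z) / 2

lemma logGammaFormula_add_one {i : ℕ} (hi : i < 3) {z : ℂ} (hz : 0 < z.re) :
    logGammaFormula (i + 1) (z + 1) = logGammaFormula (i + 1) z - logGammaFormula i z := by
  interval_cases i <;> simp only [logGammaFormula, logPowSum_add_one _ hz] <;> ring

lemma logGammaFormula_one (i : ℕ) : logGammaFormula i 1 = 0 := by
  unfold logGammaFormula
  split <;> simp [logPowSum_one]

lemma differentiableAt_logGammaFormula (i : ℕ) {z : ℂ} (hz : 0 < z.re) :
    DifferentiableAt ℂ (logGammaFormula i) z := by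
  have h0 := differentiableAt_logPowSum 0 hz
  have h1 := differentiableAt_logPowSum 1 hz
  have h2 := differentiableAt_logPowSum 2 hz
  have h3 : DifferentiableAt ℂ log z := (hasDerivAt_log (Or.inl hz)).differentiableAt
  unfold logGammaFormula
  split <;> fun_prop

lemma logGammaFormula_ofReal_im (i : ℕ) {x : ℝ} (hx : 0 < x) :
    (logGammaFormula i x).im = 0 := by
  have h : ∀ j, logPowSum j x = ((logPowSum j x).re : ℂ) := fun j =>
    Complex.ext (by simp) (by simp [logPowSum_ofReal_im j hx])
  unfold logGammaFormula
  split <;> beta_reduce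
  · rw [← ofReal_log hx.le]; simp
  · exact logPowSum_ofReal_im 0 hx
  · rw [h 0, h 1]; norm_cast
  · rw [h 0, h 1, h 2]; norm_cast

lemma isOpen_re_pos : IsOpen {z : ℂ | 0 < z.re} := isOpen_lt continuous_const continuous_re

lemma analyticAt_logGammaFormula (i : ℕ) {z : ℂ} (hz : 0 < z.re) :
    AnalyticAt ℂ (logGammaFormula i) z :=
  DifferentiableOn.analyticAt (s := {z : ℂ | 0 < z.re})
    (fun _ hw => (differentiableAt_logGammaFormula i hw).differentiableWithinAt)
    (isOpen_re_pos.mem_nhds hz)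

lemma logGammaFormula_isBigO {i : ℕ} (h1 : 1 ≤ i) (h3 : i ≤ 3) :
    logGammaFormula i =O[𝓟 farHalfPlane] fun z => ‖z‖ ^ i * √‖z‖ := by
  have hc : ∀ c : ℂ, (fun z : ℂ => z - c) =O[𝓟 farHalfPlane] fun z => ‖z‖ := by
    intro c
    have e1 := zpow_isBigO_pow (a := 1) (b := 1) le_rfl
    have e2 := (zpow_isBigO_pow (a := 0) (b := 1) (by omega)).const_mul_left c
    simpa using e1.sub e2
  have hS := logPowSum_isBigO
  interval_cases i
  · have e : logGammaFormula 1 = logPowSum 0 := rfl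
    simpa [e] using hS 0
  · have e := (hS 1).sub (((hc 1).mul (hS 0)).congr_right fun z => by ring)
    exact e
  · have e1 := (((hc 1).mul (hc 2)).mul (hS 0)).congr_right (g₂ := fun z => ‖z‖ ^ 3 * √‖z‖)
      fun z => by ring
    have e2 := (((hc (3 / 2)).const_mul_left 2).mul (hS 1)).congr_right
      (g₂ := fun z => ‖z‖ ^ 3 * √‖z‖) fun z => by ring
    refine (((e1.sub e2).add (hS 2)).const_mul_left (1 / 2)).congr_left fun z => ?_
    simp only [logGammaFormula]
    ring

/-- By Cauchy's estimate on the disc of radius `x / 2`, the derivatives of order larger than the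
growth exponent decay along the positive real axis. -/
lemma tendsto_iteratedDeriv_of_isBigO {L : ℂ → ℂ}
    (hL : ∀ z : ℂ, 0 < z.re → DifferentiableAt ℂ L z) {i m : ℕ} (him : i + 1 ≤ m)
    (hO : L =O[𝓟 farHalfPlane] fun z => ‖z‖ ^ i * √‖z‖) :
    Tendsto (fun x : ℝ => iteratedDeriv m L x) atTop (𝓝 0) := by
  rw [Asymptotics.isBigO_principal] at hO
  obtain ⟨C, hC⟩ := hO
  have hb : ∀ x : ℝ, 2 ≤ x → ‖iteratedDeriv m L x‖ ≤
      (m.factorial * |C| * 2 ^ i * √2 * 2 ^ m) * (1 / √x) := by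
    intro x hx
    have hx0 : 0 < x := by linarith
    have hre : ∀ w ∈ Metric.closedBall (x : ℂ) (x / 2), x / 2 ≤ w.re := by
      intro w hw
      have h := (abs_re_le_norm (w - x)).trans (by simpa [dist_eq_norm] using hw)
      rw [sub_re, ofReal_re] at h
      have := (abs_le.1 h).1
      linarith
    have hd : DiffContOnCl ℂ L (Metric.ball (x : ℂ) (x / 2)) := by
      apply DifferentiableOn.diffContOnCl
      intro w hw
      have := hre w (Metric.closure_ball_subset_closedBall hw)
      exact (hL w (by linarith)).differentiableWithinAt
    have h := norm_iteratedDeriv_le_of_forall_mem_sphere_norm_le m (by linarith) hd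
      (C := |C| * ((2 * x) ^ i * √(2 * x))) ?_
    · refine h.trans ?_
      have e1 : √(2 * x) = √2 * √x := Real.sqrt_mul (by norm_num) x
      have e2 : √x * √x = x := Real.mul_self_sqrt hx0.le
      have e3 : 0 < √x := Real.sqrt_pos.2 hx0
      have e4 : x ^ i * x ≤ x ^ m := by
        rw [← pow_succ]; exact pow_le_pow_right₀ (by linarith) him
      rw [e1, div_pow, mul_pow, div_div_eq_mul_div, div_le_iff₀ (by positivity)]
      have e5 : x ^ i * √x ≤ 1 / √x * x ^ m := by
        rw [one_div, inv_mul_eq_div, le_div_iff₀ e3, mul_assoc, e2]; exact e4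
      calc (m.factorial : ℝ) * (|C| * (2 ^ i * x ^ i * (√2 * √x))) * 2 ^ m
          = (m.factorial * |C| * 2 ^ i * √2 * 2 ^ m) * (x ^ i * √x) := by ring
        _ ≤ (m.factorial * |C| * 2 ^ i * √2 * 2 ^ m) * (1 / √x * x ^ m) := by gcongr
        _ = _ := by ring
    · intro w hw
      have h1 := hre w (Metric.sphere_subset_closedBall hw)
      have h2 : x / 2 ≤ ‖w‖ := h1.trans (re_le_norm w)
      have h3 : ‖w‖ ≤ 2 * x := by
        have h4 : ‖w - x‖ = x / 2 := by simpa [dist_eq_norm] using hw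
        have h5 := norm_le_norm_add_norm_sub (x : ℂ) w
        rw [norm_real, Real.norm_of_nonneg hx0.le, norm_sub_rev, h4] at h5
        linarith
      refine (hC w ⟨by linarith, by linarith⟩).trans ?_
      rw [Real.norm_of_nonneg (by positivity)]
      refine mul_le_mul (le_abs_self C) ?_ (by positivity) (abs_nonneg C)
      gcongr
  have hlim : Tendsto (fun x : ℝ => (m.factorial * |C| * 2 ^ i * √2 * 2 ^ m) * (1 / √x)) atTop
      (𝓝 0) := by
    rw [← mul_zero (m.factorial * |C| * 2 ^ i * √2 * 2 ^ m)]
    exact (Real.tendsto_sqrt_atTop.const_div_atTop 1).const_mul _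
  exact squeeze_zero_norm' ((eventually_ge_atTop 2).mono hb) hlim

lemma iteratedDeriv_logGammaFormula_add_one {i : ℕ} (hi : i < 3) (m : ℕ) {x : ℝ} (hx : 0 < x) :
    iteratedDeriv m (logGammaFormula (i + 1)) ((x + 1 : ℝ) : ℂ) =
      iteratedDeriv m (logGammaFormula (i + 1)) x - iteratedDeriv m (logGammaFormula i) x := by
  have hx' : 0 < (x : ℂ).re := by simpa using hx
  have h1 : (fun z => logGammaFormula (i + 1) (z + 1)) =ᶠ[𝓝 (x : ℂ)]
      logGammaFormula (i + 1) - logGammaFormula i := by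
    filter_upwards [isOpen_re_pos.mem_nhds hx'] with z hz
    exact logGammaFormula_add_one hi hz
  have h2 := h1.iteratedDeriv_eq m
  rw [iteratedDeriv_comp_add_const, iteratedDeriv_sub
    (analyticAt_logGammaFormula _ hx').contDiffAt
    (analyticAt_logGammaFormula _ hx').contDiffAt] at h2
  rw [← h2]
  simp

/-- Sign of the derivatives of `log Γ₀ = -log`. -/
lemma iteratedDeriv_neg_log_nonneg {m : ℕ} (hm : 1 ≤ m) {x : ℝ} (hx : 0 < x) :
    0 ≤ (-1) ^ m * (iteratedDeriv m (logGammaFormula 0) x).re := by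
  obtain ⟨n, rfl⟩ : ∃ n, m = n + 1 := ⟨m - 1, by omega⟩
  have h0 : logGammaFormula 0 = -log := rfl
  rw [h0, iteratedDeriv_neg, iteratedDeriv_succ_log (Or.inl (by simpa using hx))]
  have e : -((-1) ^ n * (n.factorial : ℂ) * (x : ℂ) ^ (-(n : ℤ) - 1)) =
      ((-((-1) ^ n * (n.factorial : ℝ) * x ^ (-(n : ℤ) - 1)) : ℝ) : ℂ) := by push_cast; rfl
  rw [e, ofReal_re]
  have e2 : (-1 : ℝ) ^ (n + 1) * -((-1) ^ n * (n.factorial : ℝ) * x ^ (-(n : ℤ) - 1)) =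
      ((-1 : ℝ) ^ n) ^ 2 * ((n.factorial : ℝ) * x ^ (-(n : ℤ) - 1)) := by ring
  rw [e2]
  positivity

/-- Complete monotonicity: the derivatives of `log Γᵢ` of order larger than `i` alternate in sign.
Since they decay at infinity, they are the sums of the corresponding derivatives of `log Γᵢ₋₁`. -/
lemma iteratedDeriv_logGammaFormula_nonneg {i : ℕ} (hi : i ≤ 3) : ∀ {m : ℕ}, i + 1 ≤ m →
    ∀ {x : ℝ}, 0 < x → 0 ≤ (-1) ^ m * (iteratedDeriv m (logGammaFormula i) x).re := by
  induction i with
  | zero => exact fun hm x hx => iteratedDeriv_neg_log_nonneg hm hx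
  | succ i ih =>
    intro m hm x hx
    have hstep : ∀ K : ℕ, (-1) ^ m * (iteratedDeriv m (logGammaFormula (i + 1))
        ((x + K : ℝ) : ℂ)).re ≤ (-1) ^ m * (iteratedDeriv m (logGammaFormula (i + 1)) x).re := by
      intro K
      induction K with
      | zero => simp
      | succ K ihK =>
        refine le_trans ?_ ihK
        have hxK : 0 < x + K := by positivity
        have h1 := iteratedDeriv_logGammaFormula_add_one (show i < 3 by omega) m hxK
        have h2 := ih (by omega) (m := m) (by omega) hxK
        rw [show x + ((K + 1 : ℕ) : ℝ) = x + K + 1 by push_cast; ring, h1, sub_re]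
        linarith
    have hlim := tendsto_iteratedDeriv_of_isBigO
      (fun z hz => differentiableAt_logGammaFormula (i + 1) hz) hm
      (logGammaFormula_isBigO (by omega) hi)
    have h1 : Tendsto (fun K : ℕ => x + (K : ℝ)) atTop atTop :=
      tendsto_atTop_add_const_left _ _ tendsto_natCast_atTop_atTop
    have h2 := ((continuous_re.tendsto _).comp (hlim.comp h1)).const_mul ((-1 : ℝ) ^ m)
    rw [zero_re, mul_zero] at h2
    exact le_of_tendsto' h2 hstep

/-- Derivatives along the real axis of the real part of a holomorphic function. -/
lemma iteratedDeriv_re_eq {L : ℂ → ℂ} (hL : ∀ z : ℂ, 0 < z.re → AnalyticAt ℂ L z) (m : ℕ) :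
    ∀ {x : ℝ}, 0 < x →
      iteratedDeriv m (fun t : ℝ => (L t).re) x = (iteratedDeriv m L x).re := by
  induction m with
  | zero => intro x _; simp
  | succ m ih =>
    intro x hx
    have hx' : 0 < (x : ℂ).re := by simpa using hx
    have h1 : iteratedDeriv m (fun t : ℝ => (L t).re) =ᶠ[𝓝 x]
        fun t : ℝ => (iteratedDeriv m L t).re := by
      filter_upwards [Ioi_mem_nhds hx] with t ht
      exact ih ht
    have h2 : HasDerivAt (iteratedDeriv m L) (iteratedDeriv (m + 1) L x) x := by
      rw [iteratedDeriv_succ, iteratedDeriv_eq_iterate]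
      exact ((hL x hx').iterated_deriv m).differentiableAt.hasDerivAt
    rw [iteratedDeriv_succ, h1.deriv_eq]
    exact h2.real_of_complex.deriv

/-! ### Tools for existence and uniqueness -/

/-- Two holomorphic functions on the right half-plane that agree on the positive real axis are
equal. -/
lemma eq_of_eq_on_pos_real {F G : ℂ → ℂ} (hF : ∀ z : ℂ, 0 < z.re → DifferentiableAt ℂ F z)
    (hG : ∀ z : ℂ, 0 < z.re → DifferentiableAt ℂ G z) (h : ∀ x : ℝ, 0 < x → F x = G x)
    {z : ℂ} (hz : 0 < z.re) : F z = G z := by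
  have hF' : AnalyticOnNhd ℂ F {z | 0 < z.re} := DifferentiableOn.analyticOnNhd
    (fun w hw => (hF w hw).differentiableWithinAt) isOpen_re_pos
  have hG' : AnalyticOnNhd ℂ G {z | 0 < z.re} := DifferentiableOn.analyticOnNhd
    (fun w hw => (hG w hw).differentiableWithinAt) isOpen_re_pos
  have hpre : IsPreconnected {z : ℂ | 0 < z.re} := (convex_halfSpace_re_gt 0).isPreconnected
  have hlim : Tendsto (fun k : ℕ => ((1 + 1 / ((k : ℝ) + 1) : ℝ) : ℂ)) atTop (𝓝[≠] 1) := by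
    rw [tendsto_nhdsWithin_iff]
    constructor
    · have h1 := (tendsto_one_div_add_atTop_nhds_zero_nat (𝕜 := ℝ)).const_add 1
      rw [add_zero] at h1
      have h2 := (continuous_ofReal.tendsto 1).comp h1
      rw [ofReal_one] at h2
      exact h2
    · refine Eventually.of_forall fun k => ?_
      rw [mem_compl_singleton_iff, Ne, ofReal_eq_one]
      have : (0 : ℝ) < 1 / ((k : ℝ) + 1) := by positivity
      linarith
  have hfreq : ∃ᶠ w in 𝓝[≠] (1 : ℂ), F w = G w :=
    hlim.frequently (Frequently.of_forall fun k => h _ (by positivity))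
  exact hF'.eqOn_of_preconnected_of_frequently_eq hG' hpre (by simp) hfreq hz

lemma logGammaFormula_ofReal (i : ℕ) {x : ℝ} (hx : 0 < x) :
    logGammaFormula i x = ((logGammaFormula i x).re : ℂ) :=
  Complex.ext (by simp) (by simp [logGammaFormula_ofReal_im i hx])

lemma iteratedDeriv_re_logGammaFormula_nonneg {i : ℕ} (hi : i ≤ 3) {m : ℕ} (hm : i + 1 ≤ m)
    {x : ℝ} (hx : 0 < x) :
    0 ≤ (-1) ^ m * iteratedDeriv m (fun t : ℝ => (logGammaFormula i t).re) x := by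
  rw [iteratedDeriv_re_eq (fun z hz => analyticAt_logGammaFormula i hz) m hx]
  exact iteratedDeriv_logGammaFormula_nonneg hi hm hx

lemma contDiffAt_re_logGammaFormula (i : ℕ) (n : WithTop ℕ∞) {x : ℝ} (hx : 0 < x) :
    ContDiffAt ℝ n (fun t : ℝ => (logGammaFormula i t).re) x :=
  (analyticAt_logGammaFormula i (z := x) (by simpa using hx)).contDiffAt.real_of_complex

lemma differentiableAt_iteratedDeriv_of_contDiffAt {p : ℝ → ℝ} {x : ℝ}
    {m : ℕ} (hp : ContDiffAt ℝ (m + 1 : ℕ) p x) : DifferentiableAt ℝ (iteratedDeriv m p) x := by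
  rw [← contDiffWithinAt_univ] at hp
  have h := hp.differentiableWithinAt_iteratedDerivWithin (m := m)
    (by exact_mod_cast Nat.lt_succ_self m) (by simp)
  rwa [differentiableWithinAt_univ, iteratedDerivWithin_univ] at h

lemma exp_logGammaFormula_ofReal (i : ℕ) {x : ℝ} (hx : 0 < x) :
    exp (logGammaFormula i x) = ((Real.exp (logGammaFormula i x).re : ℝ) : ℂ) := by
  rw [ofReal_exp, ← logGammaFormula_ofReal i hx]

/-- By the Bohr–Mollerup theorem, `logGammaFormula 1` is a logarithm of the gamma function. -/
lemma exp_logGammaFormula_one {z : ℂ} (hz : 0 < z.re) : exp (logGammaFormula 1 z) = Gamma z := by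
  refine eq_of_eq_on_pos_real (F := fun z => exp (logGammaFormula 1 z))
    (fun w hw => (differentiableAt_logGammaFormula 1 hw).cexp)
    (fun w hw => differentiableAt_Gamma w fun m h => ?_) (fun x hx => ?_) hz
  · rw [h] at hw
    simp at hw
    linarith [(m.cast_nonneg : (0 : ℝ) ≤ m)]
  · have hv : ∀ y ∈ Ioi (0 : ℝ), ContDiffAt ℝ 2 (fun t : ℝ => (logGammaFormula 1 t).re) y :=
      fun y hy => contDiffAt_re_logGammaFormula 1 2 hy
    have key := Real.eq_Gamma_of_log_convex
      (f := fun t : ℝ => Real.exp (logGammaFormula 1 t).re) ?_ ?_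
      (fun _ => Real.exp_pos _) (by simp [logGammaFormula_one]) (mem_Ioi.2 hx)
    · beta_reduce at key
      rw [exp_logGammaFormula_ofReal 1 hx, key, Gamma_ofReal]
    · have e : Real.log ∘ (fun t : ℝ => Real.exp (logGammaFormula 1 t).re) =
          fun t : ℝ => (logGammaFormula 1 t).re := by
        funext t; simp
      rw [e]
      refine convexOn_of_deriv2_nonneg' (convex_Ioi 0)
        (fun y hy => ((hv y hy).differentiableAt (by norm_num)).differentiableWithinAt)
        (fun y hy => ?_) fun y hy => ?_
      · have := differentiableAt_iteratedDeriv_of_contDiffAt (m := 1) (hv y hy)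
        rw [iteratedDeriv_one] at this
        exact this.differentiableWithinAt
      · have := iteratedDeriv_re_logGammaFormula_nonneg (i := 1) (by norm_num) (m := 2) le_rfl hy
        rw [iteratedDeriv_eq_iterate] at this
        simpa using this
    · intro y hy
      have h1 := logGammaFormula_add_one (i := 0) (by norm_num) (z := y) (by simpa using hy)
      have h2 : logGammaFormula 0 y = -(Real.log y : ℂ) := by
        rw [ofReal_log hy.le]; rfl
      simp only [zero_add] at h1
      push_cast
      rw [h1, h2, sub_neg_eq_add, add_re, ofReal_re, Real.exp_add, Real.exp_log hy, mul_comm]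

/-- The domain of holomorphy of the multiple gamma functions. -/
def gammaDomain : Set ℂ := {z : ℂ | ∀ m : ℕ, z ≠ -(m : ℂ)}

lemma mem_gammaDomain_of_re_pos {z : ℂ} (hz : 0 < z.re) : z ∈ gammaDomain := by
  intro m h
  rw [h] at hz
  simp at hz
  linarith [(m.cast_nonneg : (0 : ℝ) ≤ m)]

lemma add_natCast_mem_gammaDomain {z : ℂ} (hz : z ∈ gammaDomain) (k : ℕ) :
    z + k ∈ gammaDomain := by
  intro m h
  refine hz (m + k) ?_
  push_cast
  linear_combination h

/-- A holomorphic solution of `g (z + 1) = g z / f z` on the right half-plane extends to the whole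
domain of `f` by means of the recurrence. -/
lemma exists_extension {f h : ℂ → ℂ} (hf : DifferentiableOn ℂ f gammaDomain)
    (hf0 : ∀ z ∈ gammaDomain, f z ≠ 0) (hh : ∀ z : ℂ, 0 < z.re → DifferentiableAt ℂ h z)
    (hrec : ∀ z : ℂ, 0 < z.re → h (z + 1) = h z / f z) :
    ∃ g : ℂ → ℂ, DifferentiableOn ℂ g gammaDomain ∧ (∀ z : ℂ, 0 < z.re → g z = h z) ∧
      ∀ z ∈ gammaDomain, g (z + 1) = g z / f z := by
  set G : ℕ → ℂ → ℂ := fun N z => h (z + N) * ∏ k ∈ Finset.range N, f (z + k) with hG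
  have hstep : ∀ z : ℂ, ∀ N M : ℕ, N ≤ M → 0 < (z + N).re → G M z = G N z := by
    intro z N M hNM hN
    induction M, hNM using Nat.le_induction with
    | base => rfl
    | succ M hM ih =>
      have hM' : 0 < (z + M).re := by
        have : (N : ℝ) ≤ M := by exact_mod_cast hM
        simp at hN ⊢
        linarith
      rw [← ih]
      simp only [hG, Finset.prod_range_succ]
      push_cast
      rw [← add_assoc, hrec _ hM']
      have := hf0 _ (mem_gammaDomain_of_re_pos hM')
      field_simp
  set n : ℂ → ℕ := fun z => ⌈|z.re|⌉₊ + 1 with hn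
  have hn' : ∀ z : ℂ, 0 < (z + n z).re := by
    intro z
    have h1 := Nat.le_ceil |z.re|
    have h2 := neg_abs_le z.re
    simp [hn]
    linarith
  have heq : ∀ z : ℂ, ∀ N : ℕ, 0 < (z + N).re → G (n z) z = G N z := by
    intro z N hN
    rw [← hstep z N _ (le_max_left N (n z)) hN, hstep z (n z) _ (le_max_right N (n z)) (hn' z)]
  refine ⟨fun z => G (n z) z, fun z hz => ?_, fun z hz => ?_, fun z hz => ?_⟩
  · have hmaps : ∀ k : ℕ, MapsTo (fun w => w + (k : ℂ)) gammaDomain gammaDomain :=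
      fun k w hw => add_natCast_mem_gammaDomain hw k
    have hd : DifferentiableWithinAt ℂ (G (n z)) gammaDomain z := by
      refine DifferentiableWithinAt.mul ?_ ?_
      · exact (differentiableAt_comp_add_const.2 (hh _ (hn' z))).differentiableWithinAt
      · refine DifferentiableWithinAt.fun_finsetProd fun k _ => ?_
        exact (hf _ (hmaps k hz)).comp z (by fun_prop) (hmaps k)
    refine hd.congr_of_eventuallyEq ?_ rfl
    have hopen : IsOpen {w : ℂ | 0 < (w + n z).re} :=
      isOpen_re_pos.preimage (continuous_id.add continuous_const)
    filter_upwards [nhdsWithin_le_nhds (hopen.mem_nhds (hn' z))] with w hw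
    exact heq w _ hw
  · have := heq z 0 (by simpa using hz)
    simpa [hG] using this
  · have h1 : 0 < (z + ((n z + 1 : ℕ) : ℂ)).re := by
      have := hn' z
      simp at this ⊢
      linarith
    have h2 : 0 < (z + 1 + (n z : ℂ)).re := by
      have := hn' z
      simp at this ⊢
      linarith
    beta_reduce
    rw [heq z _ h1, heq (z + 1) _ h2]
    simp only [hG, Finset.prod_range_succ']
    have h3 := hf0 z hz
    push_cast
    rw [add_zero, eq_div_iff h3, show z + 1 + (n z : ℂ) = z + ((n z : ℂ) + 1) by ring, mul_assoc]
    congr 2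
    refine Finset.prod_congr rfl fun k _ => ?_
    congr 1
    ring

/-- A smooth `1`-periodic function on the positive axis one of whose derivatives has constant sign
is constant: that derivative vanishes by periodicity of the preceding one, and Rolle's theorem
carries the vanishing down to the first derivative. -/
lemma eq_of_periodic_of_iteratedDeriv_nonneg {p : ℝ → ℝ}
    (hp : ∀ x : ℝ, 0 < x → ∀ n : ℕ, ContDiffAt ℝ n p x) (hper : ∀ x : ℝ, 0 < x → p (x + 1) = p x)
    {n : ℕ} {s : ℝ} (hs : s ≠ 0) (hsign : ∀ x : ℝ, 0 < x → 0 ≤ s * iteratedDeriv (n + 1) p x)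
    {x y : ℝ} (hx : 0 < x) (hy : 0 < y) : p x = p y := by
  have hderiv : ∀ m : ℕ, ∀ x : ℝ, 0 < x →
      HasDerivAt (iteratedDeriv m p) (iteratedDeriv (m + 1) p x) x := by
    intro m x hx
    rw [iteratedDeriv_succ]
    exact (differentiableAt_iteratedDeriv_of_contDiffAt (hp x hx (m + 1))).hasDerivAt
  have hperm : ∀ m : ℕ, ∀ x : ℝ, 0 < x → iteratedDeriv m p (x + 1) = iteratedDeriv m p x := by
    intro m x hx
    have h1 : (fun t => p (t + 1)) =ᶠ[𝓝 x] p := by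
      filter_upwards [Ioi_mem_nhds hx] with t ht
      exact hper t ht
    have h2 := h1.iteratedDeriv_eq m
    rw [iteratedDeriv_comp_add_const] at h2
    exact h2
  have htop : ∀ x y : ℝ, 0 < x → x ≤ y → iteratedDeriv n p x = iteratedDeriv n p y := by
    have hmono : MonotoneOn (fun x => s * iteratedDeriv n p x) (Ioi 0) := by
      refine monotoneOn_of_deriv_nonneg (convex_Ioi 0) ?_ ?_ ?_
      · exact fun x hx => ((hderiv n x hx).const_mul s).continuousAt.continuousWithinAt
      · rw [interior_Ioi]
        exact fun x hx => ((hderiv n x hx).const_mul s).differentiableAt.differentiableWithinAt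
      · rw [interior_Ioi]
        intro x hx
        rw [((hderiv n x hx).const_mul s).deriv]
        exact hsign x hx
    intro x y hx hxy
    have hK : ∀ K : ℕ, iteratedDeriv n p (x + K) = iteratedDeriv n p x := by
      intro K
      induction K with
      | zero => simp
      | succ K ih =>
        rw [← ih, ← hperm n (x + K) (by positivity)]
        push_cast
        ring_nf
    obtain ⟨K, hK'⟩ := exists_nat_ge (y - x)
    have h1 := hmono (mem_Ioi.2 hx) (mem_Ioi.2 (hx.trans_le hxy)) hxy
    have h2 := hmono (mem_Ioi.2 (hx.trans_le hxy))
      (mem_Ioi.2 (by positivity : 0 < x + (K : ℝ))) (by linarith)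
    simp only [hK] at h2
    exact mul_left_cancel₀ hs (le_antisymm h1 h2)
  have hconst : ∀ m ≤ n, ∀ x y : ℝ, 0 < x → 0 < y →
      iteratedDeriv m p x = iteratedDeriv m p y := by
    intro m hm
    induction hm using Nat.decreasingInduction with
    | self =>
      intro x y hx hy
      rcases le_total x y with h | h
      · exact htop x y hx h
      · exact (htop y x hy h).symm
    | of_succ m hm ih =>
      obtain ⟨c, hc, hc0⟩ := exists_hasDerivAt_eq_zero (f := iteratedDeriv m p)
        (f' := iteratedDeriv (m + 1) p) (a := 1) (b := 1 + 1) (by norm_num)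
        (fun x hx => (hderiv m x (by linarith [hx.1])).continuousAt.continuousWithinAt)
        (hperm m 1 one_pos).symm (fun x hx => hderiv m x (by linarith [hx.1]))
      have hzero : ∀ x : ℝ, 0 < x → iteratedDeriv (m + 1) p x = 0 := fun x hx =>
        (ih x c hx (by linarith [hc.1])).trans hc0
      intro x y hx hy
      refine isOpen_Ioi.is_const_of_deriv_eq_zero isPreconnected_Ioi
        (fun t ht => (hderiv m t ht).differentiableAt.differentiableWithinAt)
        (fun t ht => ?_) (mem_Ioi.2 hx) (mem_Ioi.2 hy)
      rw [(hderiv m t ht).deriv]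
      exact hzero t ht
  simpa using hconst 0 (Nat.zero_le _) x y hx hy

/-! ### The multiple gamma functions in terms of the explicit logarithms -/

/-- `f` is holomorphic and free of zeros on the domain of the multiple gamma functions, and
`logGammaFormula i` is a logarithm of it on the right half-plane. -/
structure HasLogGammaFormula (i : ℕ) (f : ℂ → ℂ) : Prop where
  holomorphic : DifferentiableOn ℂ f gammaDomain
  ne_zero : ∀ z ∈ gammaDomain, f z ≠ 0
  eq_exp : ∀ z : ℂ, 0 < z.re → f z = exp (logGammaFormula i z)

lemma hasLogGammaFormula_Gamma : HasLogGammaFormula 1 Gamma where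
  holomorphic := fun z hz => (differentiableAt_Gamma z hz).differentiableWithinAt
  ne_zero := fun _ hz => Gamma_ne_zero hz
  eq_exp := fun _ hz => (exp_logGammaFormula_one hz).symm

lemma exists_isMultipleGammaStep {i : ℕ} (hi : i < 3) {f : ℂ → ℂ} (hf : HasLogGammaFormula i f) :
    ∃ g, IsMultipleGammaStep (i + 1) f g := by
  obtain ⟨g, hg, hexp, hrec⟩ := exists_extension hf.holomorphic hf.ne_zero
    (h := fun z => exp (logGammaFormula (i + 1) z))
    (fun z hz => (differentiableAt_logGammaFormula _ hz).cexp)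
    (fun z hz => by rw [logGammaFormula_add_one hi hz, exp_sub, hf.eq_exp z hz])
  have hreal : ∀ x : ℝ, 0 < x →
      g x = ((Real.exp (logGammaFormula (i + 1) x).re : ℝ) : ℂ) := fun x hx => by
    rw [hexp _ (by simpa using hx), exp_logGammaFormula_ofReal _ hx]
  refine ⟨g, hg, hrec, ?_, fun x hx => ?_, fun x hx => ?_⟩
  · rw [hexp 1 (by simp), logGammaFormula_one, exp_zero]
  · rw [hreal x hx]
    exact ⟨by rw [ofReal_re]; exact Real.exp_pos _, ofReal_im _⟩
  · have h1 : (fun t : ℝ => Real.log (g t).re) =ᶠ[𝓝 x]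
        fun t : ℝ => (logGammaFormula (i + 1) t).re := by
      filter_upwards [Ioi_mem_nhds hx] with t ht
      rw [hreal t ht, ofReal_re, Real.log_exp]
    rw [h1.iteratedDeriv_eq]
    exact iteratedDeriv_re_logGammaFormula_nonneg (by omega) le_rfl hx

/-- Uniqueness of the multiple gamma functions on the positive axis. The difference of two
logarithms is periodic, and the derivative in the convexity condition has a sign since the one of
the explicit logarithm decays at infinity. -/
lemma log_eq_of_isMultipleGammaStep {i : ℕ} (hi : i < 3) {f g : ℂ → ℂ}
    (hf : HasLogGammaFormula i f) (hg : IsMultipleGammaStep (i + 1) f g) {x : ℝ} (hx : 0 < x) :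
    Real.log (g x).re = (logGammaFormula (i + 1) x).re := by
  set u : ℝ → ℝ := fun t => Real.log (g t).re with hu
  set v : ℝ → ℝ := fun t => (logGammaFormula (i + 1) t).re with hv
  have hgan : ∀ x : ℝ, 0 < x → AnalyticAt ℂ g x := fun x hx =>
    DifferentiableOn.analyticAt (s := {z : ℂ | 0 < z.re})
      (hg.holomorphic.mono fun z hz => mem_gammaDomain_of_re_pos hz)
      (isOpen_re_pos.mem_nhds (by simpa using hx))
  have hcu : ∀ x : ℝ, 0 < x → ∀ n : ℕ, ContDiffAt ℝ n u x := fun x hx n =>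
    (hgan x hx).contDiffAt.real_of_complex.log (hg.pos x hx).1.ne'
  have hcv : ∀ x : ℝ, 0 < x → ∀ n : ℕ, ContDiffAt ℝ n v x := fun x hx n =>
    contDiffAt_re_logGammaFormula _ n hx
  have hper : ∀ x : ℝ, 0 < x → (u - v) (x + 1) = (u - v) x := by
    intro x hx
    have hx' : 0 < (x : ℂ).re := by simpa using hx
    have h1 := hg.map_add_one x (mem_gammaDomain_of_re_pos hx')
    have h2 : (g x) = ((g x).re : ℂ) := Complex.ext (by simp) (by simp [(hg.pos x hx).2])
    rw [hf.eq_exp _ hx', exp_logGammaFormula_ofReal i hx, h2, ← ofReal_div] at h1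
    have h3 := logGammaFormula_add_one hi hx'
    simp only [Pi.sub_apply, hu, hv]
    push_cast
    rw [h1, h3, ofReal_re, sub_re, Real.log_div (hg.pos x hx).1.ne' (Real.exp_pos _).ne',
      Real.log_exp]
    ring
  have hsign : ∀ x : ℝ, 0 < x →
      0 ≤ (-1) ^ (i + 1 + 1) * iteratedDeriv (i + 1 + 1) (u - v) x := by
    intro x hx
    have hpK : ∀ K : ℕ, iteratedDeriv (i + 1 + 1) (u - v) (x + K) =
        iteratedDeriv (i + 1 + 1) (u - v) x := by
      intro K
      induction K with
      | zero => simp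
      | succ K ih =>
        have h1 : (fun t => (u - v) (t + 1)) =ᶠ[𝓝 (x + K)] (u - v) := by
          filter_upwards [Ioi_mem_nhds (show 0 < x + K by positivity)] with t ht
          exact hper t ht
        have h2 := h1.iteratedDeriv_eq (i + 1 + 1)
        rw [iteratedDeriv_comp_add_const, ih] at h2
        rw [← h2]
        push_cast
        ring_nf
    have hlim := tendsto_iteratedDeriv_of_isBigO
      (fun z hz => differentiableAt_logGammaFormula (i + 1) hz) (m := i + 1 + 1) le_rfl
      (logGammaFormula_isBigO (by omega) (by omega))
    have h1 : Tendsto (fun K : ℕ => x + (K : ℝ)) atTop atTop :=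
      tendsto_atTop_add_const_left _ _ tendsto_natCast_atTop_atTop
    have h2 := ((continuous_re.tendsto _).comp (hlim.comp h1)).const_mul
      (-(-1 : ℝ) ^ (i + 1 + 1))
    rw [zero_re, mul_zero] at h2
    -- at `x + K` the derivative of `u` has the required sign and that of `v` is small
    refine le_of_tendsto' h2 fun K => ?_
    have hxK : 0 < x + K := by positivity
    have h3 := hg.convex (x + K) hxK
    have h4 := iteratedDeriv_re_eq (fun z hz => analyticAt_logGammaFormula (i + 1) hz)
      (i + 1 + 1) hxK
    rw [← hpK K, iteratedDeriv_sub (hcu _ hxK _) (hcv _ hxK _)]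
    simp only [Function.comp_apply]
    rw [← h4]
    simp only [hu, hv]
    linarith
  have h := eq_of_periodic_of_iteratedDeriv_nonneg
    (fun x hx n => (hcu x hx n).sub (hcv x hx n)) hper (s := (-1) ^ (i + 1 + 1))
    (by simp) hsign hx one_pos
  have h1 : u 1 - v 1 = 0 := by
    simp [hu, hv, hg.map_one, logGammaFormula_one]
  exact sub_eq_zero.1 (h.trans h1)

lemma hasLogGammaFormula_of_isMultipleGammaStep {i : ℕ} (hi : i < 3) {f g : ℂ → ℂ}
    (hf : HasLogGammaFormula i f) (hg : IsMultipleGammaStep (i + 1) f g) :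
    HasLogGammaFormula (i + 1) g := by
  have hexp : ∀ z : ℂ, 0 < z.re → g z = exp (logGammaFormula (i + 1) z) := by
    intro z hz
    refine eq_of_eq_on_pos_real (F := g) (G := fun z => exp (logGammaFormula (i + 1) z))
      (fun w hw => ?_) (fun w hw => (differentiableAt_logGammaFormula _ hw).cexp)
      (fun x hx => ?_) hz
    · refine DifferentiableOn.differentiableAt (s := {z : ℂ | 0 < z.re})
        (hg.holomorphic.mono fun z hz => mem_gammaDomain_of_re_pos hz)
        (isOpen_re_pos.mem_nhds hw)
    · have h := log_eq_of_isMultipleGammaStep hi hf hg hx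
      rw [exp_logGammaFormula_ofReal _ hx, ← h, Real.exp_log (hg.pos x hx).1]
      exact Complex.ext (by simp) (by simp [(hg.pos x hx).2])
  refine ⟨hg.holomorphic, fun z hz h0 => ?_, hexp⟩
  have hK : ∀ K : ℕ, g (z + K) = 0 := by
    intro K
    induction K with
    | zero => simpa using h0
    | succ K ih =>
      have := hg.map_add_one _ (add_natCast_mem_gammaDomain hz K)
      rw [ih, zero_div] at this
      push_cast
      rw [← add_assoc, this]
  obtain ⟨K, hK'⟩ := exists_nat_gt (-z.re)
  have hre : 0 < (z + K).re := by simp; linarith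
  exact exp_ne_zero _ ((hexp _ hre).symm.trans (hK K))

lemma hasLogGammaFormula_multipleGamma_two : HasLogGammaFormula 2 (multipleGamma 2) :=
  hasLogGammaFormula_of_isMultipleGammaStep (by norm_num) hasLogGammaFormula_Gamma
    (Classical.epsilon_spec (exists_isMultipleGammaStep (by norm_num) hasLogGammaFormula_Gamma))

lemma hasLogGammaFormula_multipleGamma_three : HasLogGammaFormula 3 (multipleGamma 3) :=
  hasLogGammaFormula_of_isMultipleGammaStep (by norm_num) hasLogGammaFormula_multipleGamma_two
    (Classical.epsilon_spec
      (exists_isMultipleGammaStep (by norm_num) hasLogGammaFormula_multipleGamma_two))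

lemma logMultipleGamma_three_eq {z : ℂ} (hz : 0 < z.re) :
    logMultipleGamma 3 z = logGammaFormula 3 z := by
  have hre : ∀ t ∈ uIcc (0 : ℝ) 1, 0 < (1 + (t : ℂ) * (z - 1)).re := by
    intro t ht
    rw [uIcc_of_le zero_le_one] at ht
    rw [add_re, one_re, re_ofReal_mul, sub_re, one_re]
    rcases ht.1.eq_or_lt with h | h
    · simp [← h]
    · nlinarith [mul_pos h hz, ht.2]
  have hlog : ∀ w : ℂ, 0 < w.re →
      logDeriv (multipleGamma 3) w = deriv (logGammaFormula 3) w := by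
    intro w hw
    have h1 : multipleGamma 3 =ᶠ[𝓝 w] fun z => exp (logGammaFormula 3 z) := by
      filter_upwards [isOpen_re_pos.mem_nhds hw] with z hz
      exact hasLogGammaFormula_multipleGamma_three.eq_exp z hz
    rw [logDeriv_apply, h1.deriv_eq, h1.eq_of_nhds,
      (differentiableAt_logGammaFormula 3 hw).hasDerivAt.cexp.deriv,
      mul_div_cancel_left₀ _ (exp_ne_zero _)]
  have hd : ∀ t ∈ uIcc (0 : ℝ) 1,
      HasDerivAt (fun t : ℝ => logGammaFormula 3 (1 + (t : ℂ) * (z - 1)))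
        ((z - 1) * deriv (logGammaFormula 3) (1 + (t : ℂ) * (z - 1))) t := by
    intro t ht
    have h1 := (differentiableAt_logGammaFormula 3 (hre t ht)).hasDerivAt
    have h2 : HasDerivAt (fun w : ℂ => 1 + w * (z - 1)) (z - 1) (t : ℂ) := by
      simpa using ((hasDerivAt_id (t : ℂ)).mul_const (z - 1)).const_add 1
    have h3 := (HasDerivAt.comp (t : ℂ) h1 h2).comp_ofReal
    rw [mul_comm] at h3
    exact h3
  have hc : ContinuousOn (fun t : ℝ =>
      (z - 1) * deriv (logGammaFormula 3) (1 + (t : ℂ) * (z - 1))) (uIcc 0 1) := by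
    intro t ht
    have h1 := (analyticAt_logGammaFormula 3 (hre t ht)).deriv.continuousAt
    have h2 : ContinuousAt (fun t : ℝ => 1 + (t : ℂ) * (z - 1)) t := by fun_prop
    exact (continuousAt_const.mul (h1.comp_of_eq h2 rfl)).continuousWithinAt
  have key := integral_eq_sub_of_hasDerivAt hd hc.intervalIntegrable
  rw [logMultipleGamma, integral_congr fun t ht => by
    rw [hlog _ (hre t ht)], key]
  simp [logGammaFormula_one]

/-! ### The asymptotic expansion -/

lemma two_mul_logGammaFormula_three_add_one {z : ℂ} (hz : 0 < z.re) :
    2 * logGammaFormula 3 (z + 1) = z * (z - 1) * logPowSum 0 z - (2 * z - 1) * logPowSum 1 z +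
      logPowSum 2 z := by
  simp only [logGammaFormula, logPowSum_add_one _ hz]
  ring

lemma logPowC_zero_add_two (q : ℕ) : logPowC 0 (q + 2) = (-1) ^ q * q.factorial := by
  induction q with
  | zero => simp [logPowC, logPowA]
  | succ q ih =>
    rw [logPowC, ih, logPowA_eq_zero 0 (by omega), Nat.factorial_succ]
    push_cast; ring

lemma logPowC_one_add_three (q : ℕ) : logPowC 1 (q + 3) = (-1) ^ q * q.factorial := by
  induction q with
  | zero => norm_num [logPowC, logPowA]
  | succ q ih =>
    rw [logPowC, ih, logPowA_eq_zero 1 (by omega), Nat.factorial_succ]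
    push_cast; ring

lemma logPowC_two_add_four (q : ℕ) : logPowC 2 (q + 4) = 2 * ((-1) ^ q * q.factorial) := by
  induction q with
  | zero => norm_num [logPowC, logPowA]
  | succ q ih =>
    rw [logPowC, ih, logPowA_eq_zero 2 (by omega), Nat.factorial_succ]
    push_cast; ring

lemma logPow_eq_div {j q : ℕ} (hq : j + 2 ≤ q) (z : ℂ) :
    logPow j q z = logPowC j q / z ^ (q - 1 - j) := by
  have : ((j : ℤ) + 1 - q) = -((q - 1 - j : ℕ) : ℤ) := by omega
  rw [logPow, logPowA_eq_zero j hq, this, zpow_neg, zpow_natCast, div_eq_inv_mul]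
  simp

/-- The combination of the Euler–Maclaurin sums for `log z`, `z * log z` and `z ^ 2 * log z` that
occurs in `2 * log Γ₃ (z + 1)`. -/
lemma emSum_combination (n : ℕ) {z : ℂ} (hz : z ≠ 0) :
    z * (z - 1) * emSum (logPow 0) (2 * n + 3) z - (2 * z - 1) * emSum (logPow 1) (2 * n + 3) z +
      emSum (logPow 2) (2 * n + 3) z =
    z ^ 3 / 3 * (log z - 11 / 6) - z ^ 2 / 2 * (log z - 3 / 2) + log z / 12
      - ∑ k ∈ Finset.Icc 1 n,
          (bernoulli (2 * k + 2) : ℂ) / (4 * (k : ℂ) * ((k : ℂ) + 1) * z ^ (2 * k))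
      + ∑ k ∈ Finset.Icc 1 n, (bernoulli (2 * k + 2) : ℂ) /
          (2 * ((k : ℂ) + 1) * (2 * (k : ℂ) - 1) * z ^ (2 * k - 1)) := by
  induction n with
  | zero =>
    have h3 : bernoulli 3 = 0 := bernoulli_eq_zero_of_odd (by decide) (by norm_num)
    simp [emSum, Finset.sum_range_succ, h3, logPow, logPowA, logPowC, bernoulli_two, zpow_ofNat]
    field_simp
    ring
  | succ n ih =>
    have hodd : bernoulli (2 * n + 5) = 0 :=
      bernoulli_eq_zero_of_odd ⟨n + 2, by ring⟩ (by omega)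
    have hs : ∀ j, emSum (logPow j) (2 * (n + 1) + 3) z = emSum (logPow j) (2 * n + 3) z +
        (bernoulli (2 * n + 4) : ℂ) / ((2 * n + 4).factorial : ℂ) * logPow j (2 * n + 4) z := by
      intro j
      rw [emSum, show 2 * (n + 1) + 3 + 1 = 2 * n + 3 + 1 + 1 + 1 by ring, Finset.sum_range_succ,
        Finset.sum_range_succ, emSum, hodd]
      simp
    rw [hs, hs, hs, Finset.sum_Icc_succ_top (by omega), Finset.sum_Icc_succ_top (by omega)]
    have e0 : logPow 0 (2 * n + 4) z = ((2 * n + 2).factorial : ℂ) / z ^ (2 * n + 3) := by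
      rw [logPow_eq_div (by omega), logPowC_zero_add_two (2 * n + 2),
        Even.neg_one_pow ⟨n + 1, by ring⟩]
      simp
    have e1 : logPow 1 (2 * n + 4) z = -((2 * n + 1).factorial : ℂ) / z ^ (2 * n + 2) := by
      rw [logPow_eq_div (by omega), logPowC_one_add_three (2 * n + 1),
        Odd.neg_one_pow ⟨n, by ring⟩]
      simp
    have e2 : logPow 2 (2 * n + 4) z = 2 * ((2 * n).factorial : ℂ) / z ^ (2 * n + 1) := by
      rw [logPow_eq_div (by omega), logPowC_two_add_four (2 * n), Even.neg_one_pow ⟨n, by ring⟩]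
      simp
    rw [e0, e1, e2, show 2 * (n + 1) + 2 = 2 * n + 4 by ring,
      show 2 * (n + 1) - 1 = 2 * n + 1 by omega]
    have hf : ((2 * n).factorial : ℂ) ≠ 0 := by exact_mod_cast (2 * n).factorial_ne_zero
    have d1 : (2 * (n : ℂ) + 1) ≠ 0 := by exact_mod_cast (2 * n).succ_ne_zero
    have d2 : (n : ℂ) + 1 ≠ 0 := by exact_mod_cast n.succ_ne_zero
    have d3 : (2 * (n : ℂ) + 3) ≠ 0 := by exact_mod_cast (2 * n + 2).succ_ne_zero
    have d4 : (n : ℂ) + 2 ≠ 0 := by exact_mod_cast (n + 1).succ_ne_zero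
    have f1 : ((2 * n + 1).factorial : ℂ) = (2 * n + 1) * (2 * n).factorial := by
      rw [Nat.factorial_succ]; push_cast; ring
    have f2 : ((2 * n + 2).factorial : ℂ) = 2 * (n + 1) * ((2 * n + 1).factorial) := by
      rw [Nat.factorial_succ (2 * n + 1)]; push_cast; ring
    have f4 : ((2 * n + 4).factorial : ℂ) =
        2 * (n + 2) * ((2 * n + 3) * (2 * n + 2).factorial) := by
      rw [Nat.factorial_succ (2 * n + 3), Nat.factorial_succ (2 * n + 2)]; push_cast; ring
    rw [f4, f2, f1]
    have key : z * (z - 1) * ((bernoulli (2 * n + 4) : ℂ) /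
          (2 * (n + 2) * ((2 * n + 3) * (2 * (n + 1) * ((2 * n + 1) * (2 * n).factorial)))) *
          (2 * (n + 1) * ((2 * n + 1) * (2 * n).factorial) / z ^ (2 * n + 3))) -
        (2 * z - 1) * ((bernoulli (2 * n + 4) : ℂ) /
          (2 * (n + 2) * ((2 * n + 3) * (2 * (n + 1) * ((2 * n + 1) * (2 * n).factorial)))) *
          (-((2 * n + 1) * (2 * n).factorial) / z ^ (2 * n + 2))) +
        (bernoulli (2 * n + 4) : ℂ) /
          (2 * (n + 2) * ((2 * n + 3) * (2 * (n + 1) * ((2 * n + 1) * (2 * n).factorial)))) *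
          (2 * (2 * n).factorial / z ^ (2 * n + 1)) =
        -((bernoulli (2 * n + 4) : ℂ) / (4 * ((n + 1 : ℕ) : ℂ) * (((n + 1 : ℕ) : ℂ) + 1) *
          z ^ (2 * (n + 1)))) +
        (bernoulli (2 * n + 4) : ℂ) / (2 * (((n + 1 : ℕ) : ℂ) + 1) * (2 * ((n + 1 : ℕ) : ℂ) - 1) *
          z ^ (2 * n + 1)) := by
      push_cast
      rw [show (n : ℂ) + 1 + 1 = n + 2 by ring, show 2 * ((n : ℂ) + 1) - 1 = 2 * n + 1 by ring]
      field_simp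
      ring
    linear_combination ih + key

lemma one_div_pow_isBigO {a b : ℕ} (h : a ≤ b) :
    (fun z : ℂ => 1 / z ^ b) =O[𝓟 farHalfPlane] fun z => 1 / z ^ a := by
  rw [Asymptotics.isBigO_principal]
  refine ⟨1, fun z hz => ?_⟩
  rw [one_mul, norm_div, norm_div, norm_pow, norm_pow, norm_one]
  have := hz.2
  gcongr

lemma mul_isBigO_one_div_pow {r : ℂ → ℂ} {a b : ℕ}
    (h : r =O[𝓟 farHalfPlane] fun z => 1 / z ^ (a + b)) {p : ℂ → ℂ}
    (hp : p =O[𝓟 farHalfPlane] fun z => z ^ b) :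
    (fun z => p z * r z) =O[𝓟 farHalfPlane] fun z => 1 / z ^ a := by
  refine (hp.mul h).congr' EventuallyEq.rfl ?_
  filter_upwards [mem_principal_self _] with z hz
  have := ne_zero_of_re_pos hz.1
  rw [pow_add]
  field_simp

lemma sub_const_isBigO (c : ℂ) :
    (fun z : ℂ => z - c) =O[𝓟 farHalfPlane] fun z => z := by
  rw [Asymptotics.isBigO_principal]
  refine ⟨1 + ‖c‖, fun z hz => ?_⟩
  have := norm_sub_le z c
  nlinarith [hz.2, norm_nonneg c]

theorem lemma5p2 (n : ℕ) :
    (fun z : ℂ => 2 * logMultipleGamma 3 (z + 1) -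
        (z ^ 3 / 3 * (Complex.log z - 11 / 6)
          - z ^ 2 / 2 * (Complex.log z - 3 / 2 + 2 * deriv riemannZeta 0)
          + Complex.log z / 12
          + z * (deriv riemannZeta 0 + 2 * deriv riemannZeta (-1))
          - deriv riemannZeta (-1) - deriv riemannZeta (-2)
          - ∑ k ∈ Finset.Icc 1 n,
              (bernoulli (2 * k + 2) : ℂ) / (4 * (k : ℂ) * ((k : ℂ) + 1) * z ^ (2 * k))
          + ∑ k ∈ Finset.Icc 1 n,
              (bernoulli (2 * k + 2) : ℂ) /
                (2 * ((k : ℂ) + 1) * (2 * (k : ℂ) - 1) * z ^ (2 * k - 1))))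
      =O[Bornology.cobounded ℂ ⊓ Filter.principal {z : ℂ | 0 < z.re}]
        (fun z : ℂ => 1 / z ^ (2 * n + 1)) := by
  have hfilter : Bornology.cobounded ℂ ⊓ 𝓟 {z : ℂ | 0 < z.re} ≤ 𝓟 farHalfPlane := by
    rw [le_principal_iff, mem_inf_principal]
    have h : ∀ᶠ z in Bornology.cobounded ℂ, 1 ≤ ‖z‖ :=
      tendsto_norm_cobounded_atTop.eventually (eventually_ge_atTop 1)
    filter_upwards [h] with z hz hre
    exact ⟨hre, hz⟩
  refine Asymptotics.IsBigO.mono ?_ hfilter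
  -- One more pair of terms than required is kept, since the error bound for `logPowZeta` is
  -- not sharp; the extra pair is of the order of the error.
  have h0 := mul_isBigO_one_div_pow (a := 2 * n + 1) (b := 2)
    (logPowZeta_sub_emSum_isBigO 0 (N := 2 * (n + 1) + 3) (by omega))
    (p := fun z => z * (z - 1)) ((((Asymptotics.isBigO_refl (fun z : ℂ => z) _).mul
      (sub_const_isBigO 1))).congr_right fun z => (sq z).symm)
  have h1 := mul_isBigO_one_div_pow (a := 2 * n + 1) (b := 1)
    (logPowZeta_sub_emSum_isBigO 1 (N := 2 * (n + 1) + 3) (by omega))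
    (p := fun z => 2 * z - 1) (((sub_const_isBigO (1 / 2)).const_mul_left 2).congr
      (fun z => by ring) (fun z => (pow_one z).symm))
  have h2 : (fun z => logPowZeta 2 z - emSum (logPow 2) (2 * (n + 1) + 3) z) =O[𝓟 farHalfPlane]
      fun z => 1 / z ^ (2 * n + 1) :=
    logPowZeta_sub_emSum_isBigO 2 (N := 2 * (n + 1) + 3) (by omega)
  have h3 := (one_div_pow_isBigO (show 2 * n + 1 ≤ 2 * (n + 1) by omega)).const_mul_left
    (-((bernoulli (2 * (n + 1) + 2) : ℂ) / (4 * ((n + 1 : ℕ) : ℂ) * (((n + 1 : ℕ) : ℂ) + 1))))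
  have h4 := (one_div_pow_isBigO (show 2 * n + 1 ≤ 2 * (n + 1) - 1 by omega)).const_mul_left
    ((bernoulli (2 * (n + 1) + 2) : ℂ) /
      (2 * (((n + 1 : ℕ) : ℂ) + 1) * (2 * ((n + 1 : ℕ) : ℂ) - 1)))
  refine ((((h0.sub h1).add h2).add h3).add h4).congr' ?_ EventuallyEq.rfl
  filter_upwards [mem_principal_self _] with z hz
  have hz1 : 0 < (z + 1).re := by
    have := hz.1
    simp
    linarith
  have hE := emSum_combination (n + 1) (ne_zero_of_re_pos hz.1)
  rw [Finset.sum_Icc_succ_top (by omega), Finset.sum_Icc_succ_top (by omega),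
    div_mul_eq_div_div _ _ (z ^ (2 * (n + 1))),
    div_mul_eq_div_div _ _ (z ^ (2 * (n + 1) - 1))] at hE
  have e0 : logPowSum 0 z = logPowZeta 0 z - deriv riemannZeta 0 := by
    rw [logPowSum, logPowZeta_one_eq]; simp
  have e1 : logPowSum 1 z = logPowZeta 1 z - deriv riemannZeta (-1) := by
    rw [logPowSum, logPowZeta_one_eq]; simp
  have e2 : logPowSum 2 z = logPowZeta 2 z - deriv riemannZeta (-2) := by
    rw [logPowSum, logPowZeta_one_eq]; simp
  rw [logMultipleGamma_three_eq hz1, two_mul_logGammaFormula_three_add_one hz.1, e0, e1, e2]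
  linear_combination -hE
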